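/- Let $t,s\ge 0$, $d=t+s$, let $E=\mathbb R^{d}$ carry the form $\eta=\mathrm{Diag}(1,\dots,1,-1,\dots,-1)$ with $t$ entries $+1$ (time-like directions) and $s$ entries $-1$ (space-like directions), and let $\mathcal C_{t,s}$ be the real Clifford algebra of $E$, generated by the images $e_1,\dots,e_d$ of the standard basis, with $v^2=\eta(v,v)$ for $v\in E\subset\mathcal C_{t,s}$, and with its topology of a finite-dimensional real vector space. Let $x\mapsto\bar x$ be the linear anti-automorphism of $\mathcal C_{t,s}$ with $\overline{e_M}=(-1)^{t+1}e_M$, and put $N(x)=x\bar x$. Let $\Gamma_{t,s}$ be the group of invertible $x\in\mathcal C_{t,s}$ with $xvx^{-1}\in E$ for all $v\in E$, and let $$\mathrm{Pin}(t,s)=\{x\in\Gamma_{t,s}: N(x)\in\mathbb R,\ |N(x)|=1\},$$ $$\mathrm{Spin}(t,s)=\{x\in\mathrm{Pin}(t,s): x \text{ is even}\},\qquad \mathrm{Spin}_+(t,s)=\{x\in\mathrm{Spin}(t,s): N(x)=1\}.$$ Let $O(t,s)$ be the group of invertible real matrices $\Lambda$ with $\Lambda^{T}\eta\Lambda=\eta$,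 and let $SO_+(t,s)$ be the subgroup of those $\Lambda\in O(t,s)$ with $\det\Lambda=1$ whose upper left $t\times t$ (time-time) block has positive determinant. **Proposition.** Conjugation $\rho(x)(v)=xvx^{-1}$ (which on $\mathrm{Spin}_+(t,s)$ equals the twisted conjugation $v\mapsto\alpha(x)vx^{-1}$, where $\alpha$ is the automorphism with $\alpha(v)=-v$ on $E$) defines a continuous group homomorphism $\rho:\mathrm{Spin}_+(t,s)\to SO_+(t,s)$ that is surjective, has kernel $\{1,-1\}$, and is a covering map all of whose fibres have exactly two points. If $M\neq N$ are two directions of the same type (both space-like or both time-like), then $$R(\theta)=\cos\tfrac{\theta}{2}+\sin\tfrac{\theta}{2}\,e_Me_N$$ is a continuous path in $\mathrm{Spin}_+(t,s)$ with $R(0)=1$ and $R(2\pi)=-1$. If $t\ge 2$ or $s\ge 2$, the covering is non-trivial: it is not isomorphic, over $SO_+(t,s)$, to the product $SO_+(t,s)\times\{0,1\}$ with a discrete two-point space, and it has no continuous section. -/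

import Mathlib

open scoped Matrix

namespace SpinCover

/-- The diagonal of the metric `η`: `+1` on the `t` time-like directions (`Sum.inl`) and `-1` on
the `s` space-like directions (`Sum.inr`) of the standard orthonormal basis of `E = ℝ^{t+s}`. -/
def sgn (t s : ℕ) : Fin t ⊕ Fin s → ℝ :=
  Sum.elim (fun _ => 1) (fun _ => -1)

/-- The matrix `η = Diag(1, …, 1, -1, …, -1)` of signature `(t, s)`. -/
def eta (t s : ℕ) : Matrix (Fin t ⊕ Fin s) (Fin t ⊕ Fin s) ℝ :=
  Matrix.diagonal (sgn t s)

/-- The quadratic form `Q(x) = ∑_M η_{MM} (x^M)²` on `E`. -/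
noncomputable def quadForm (t s : ℕ) : QuadraticForm ℝ (Fin t ⊕ Fin s → ℝ) :=
  QuadraticMap.weightedSumSquares ℝ (sgn t s)

/-- The real Clifford algebra `𝒞_{t,s}`, in which `v² = Q(v)` for `v ∈ E`. -/
abbrev Cl (t s : ℕ) : Type :=
  CliffordAlgebra (quadForm t s)

/-- The inclusion `E → 𝒞_{t,s}`, `x^M i_M ↦ x^M e_M`. -/
noncomputable abbrev vec (t s : ℕ) : (Fin t ⊕ Fin s → ℝ) →ₗ[ℝ] Cl t s :=
  CliffordAlgebra.ι (quadForm t s)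

/-- The generator `e_M` of `𝒞_{t,s}`. -/
noncomputable def gen {t s : ℕ} (M : Fin t ⊕ Fin s) : Cl t s :=
  vec t s (Pi.single M 1)

/-- `𝒞_{t,s}` carries its canonical topology as a real vector space of finite dimension: the
module topology. Groups of units of `𝒞_{t,s}` get the induced (units) topology from it. -/
noncomputable instance instTopologicalSpaceCl (t s : ℕ) : TopologicalSpace (Cl t s) :=
  moduleTopology ℝ (Cl t s)

/-- The anti-automorphism `x ↦ x̄` of `𝒞_{t,s}` with `ē_M = (-1)^{t+1} e_M`
(see `bar_vec`, `bar_mul`). -/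
noncomputable def bar {t s : ℕ} : Cl t s →ₗ[ℝ] Cl t s :=
  CliffordAlgebra.reverse ∘ₗ
    ((CliffordAlgebra.involute : Cl t s →ₐ[ℝ] Cl t s) ^ (t + 1)).toLinearMap

theorem bar_apply {t s : ℕ} (x : Cl t s) :
    bar x = CliffordAlgebra.reverse
      (((CliffordAlgebra.involute : Cl t s →ₐ[ℝ] Cl t s) ^ (t + 1)) x) := rfl

theorem bar_one {t s : ℕ} : bar (1 : Cl t s) = 1 := by
  rw [bar_apply, map_one, CliffordAlgebra.reverse.map_one]

theorem bar_mul {t s : ℕ} (x y : Cl t s) : bar (x * y) = bar y * bar x := by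
  rw [bar_apply, map_mul, CliffordAlgebra.reverse.map_mul, ← bar_apply, ← bar_apply]

theorem involute_pow_vec {t s : ℕ} (n : ℕ) (v : Fin t ⊕ Fin s → ℝ) :
    ((CliffordAlgebra.involute : Cl t s →ₐ[ℝ] Cl t s) ^ n) (vec t s v) =
      (-1 : ℝ) ^ n • vec t s v := by
  induction n with
  | zero => simp
  | succ n ih =>
    rw [pow_succ', AlgHom.mul_apply, ih, map_smul, CliffordAlgebra.involute_ι, pow_succ]
    simp

theorem bar_vec {t s : ℕ} (v : Fin t ⊕ Fin s → ℝ) :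
    bar (vec t s v) = (-1 : ℝ) ^ (t + 1) • vec t s v := by
  rw [bar_apply, involute_pow_vec, map_smul, CliffordAlgebra.reverse_ι]

theorem involute_pow_even {t s : ℕ} (n : ℕ) {x : Cl t s}
    (hx : x ∈ CliffordAlgebra.even (quadForm t s)) :
    ((CliffordAlgebra.involute : Cl t s →ₐ[ℝ] Cl t s) ^ n) x = x := by
  induction n with
  | zero => simp
  | succ n ih =>
    rw [pow_succ', AlgHom.mul_apply, ih]
    exact CliffordAlgebra.involute_eq_of_mem_even hx

theorem bar_even {t s : ℕ} {x : Cl t s} (hx : x ∈ CliffordAlgebra.even (quadForm t s)) :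
    bar x ∈ CliffordAlgebra.even (quadForm t s) := by
  rw [bar_apply, involute_pow_even _ hx]
  exact (CliffordAlgebra.reverse_mem_evenOdd_iff _).2 hx

theorem bar_bar_even {t s : ℕ} {x : Cl t s} (hx : x ∈ CliffordAlgebra.even (quadForm t s)) :
    bar (bar x) = x := by
  rw [bar_apply (bar x), involute_pow_even _ (bar_even hx), bar_apply x, involute_pow_even _ hx,
    CliffordAlgebra.reverse_reverse]

/-- The "norm" `N(x) = x x̄`. -/
noncomputable def normCl {t s : ℕ} (x : Cl t s) : Cl t s :=
  x * bar x

/-- The Clifford group `Γ_{t,s}`: the invertible `x ∈ 𝒞_{t,s}` with `x v x⁻¹ ∈ E` for all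
`v ∈ E`. -/
noncomputable def cliffordGroup (t s : ℕ) : Subgroup (Cl t s)ˣ where
  carrier := {x | ∀ v : Fin t ⊕ Fin s → ℝ,
    (x : Cl t s) * vec t s v * ((x⁻¹ : (Cl t s)ˣ) : Cl t s) ∈ LinearMap.range (vec t s)}
  one_mem' := by
    intro v
    simp
  mul_mem' := by
    intro x y hx hy v
    obtain ⟨w, hw⟩ := hy v
    obtain ⟨u, hu⟩ := hx w
    refine ⟨u, ?_⟩
    rw [hu, hw, mul_inv_rev, Units.val_mul, Units.val_mul]
    simp only [mul_assoc]
  inv_mem' := by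
    intro x hx v
    let f : LinearMap.range (vec t s) →ₗ[ℝ] LinearMap.range (vec t s) :=
      ((LinearMap.mulRight ℝ ((x⁻¹ : (Cl t s)ˣ) : Cl t s)) ∘ₗ
        (LinearMap.mulLeft ℝ (x : Cl t s))).restrict (by
          rintro _ ⟨w, rfl⟩
          exact hx w)
    have hf : Function.Injective f := by
      intro a b hab
      have h : (x : Cl t s) * a * ((x⁻¹ : (Cl t s)ˣ) : Cl t s) =
          (x : Cl t s) * b * ((x⁻¹ : (Cl t s)ˣ) : Cl t s) := congrArg Subtype.val hab
      exact Subtype.ext (x.isUnit.mul_left_cancel ((x⁻¹).isUnit.mul_right_cancel h))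
    obtain ⟨a, ha⟩ := (LinearMap.injective_iff_surjective.1 hf) ⟨vec t s v, v, rfl⟩
    have h : (x : Cl t s) * a * ((x⁻¹ : (Cl t s)ˣ) : Cl t s) = vec t s v :=
      congrArg Subtype.val ha
    rw [← h]
    have e : ((x⁻¹ : (Cl t s)ˣ) : Cl t s) *
        ((x : Cl t s) * a * ((x⁻¹ : (Cl t s)ˣ) : Cl t s)) *
          (((x⁻¹)⁻¹ : (Cl t s)ˣ) : Cl t s) = a := by
      simp [mul_assoc]
    rw [e]
    exact a.2

/-- `Pin(t,s) = {x ∈ Γ_{t,s} : |N(x)| = 1}`; this includes that `N(x)` is a real number. -/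
def pinSet (t s : ℕ) : Set (Cl t s)ˣ :=
  {x | x ∈ cliffordGroup t s ∧
    ∃ r : ℝ, |r| = 1 ∧ normCl (x : Cl t s) = algebraMap ℝ (Cl t s) r}

/-- `Spin(t,s) = Pin(t,s) ∩ 𝒞₀_{t,s}`, with `𝒞₀_{t,s}` the even subalgebra. -/
def spinSet (t s : ℕ) : Set (Cl t s)ˣ :=
  {x | x ∈ pinSet t s ∧ (x : Cl t s) ∈ CliffordAlgebra.even (quadForm t s)}

theorem bar_eq_inv {t s : ℕ} {x : (Cl t s)ˣ} (hx : normCl (x : Cl t s) = 1) :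
    bar (x : Cl t s) = ((x⁻¹ : (Cl t s)ˣ) : Cl t s) :=
  (Units.inv_eq_of_mul_eq_one_right hx).symm

/-- `Spin₊(t,s) = {x ∈ Spin(t,s) : N(x) = 1}`. -/
noncomputable def SpinPlus (t s : ℕ) : Subgroup (Cl t s)ˣ where
  carrier := {x | x ∈ spinSet t s ∧ normCl (x : Cl t s) = 1}
  one_mem' := by
    have h : normCl ((1 : (Cl t s)ˣ) : Cl t s) = 1 := by simp [normCl, bar_one]
    exact ⟨⟨⟨one_mem _, 1, by simp, by rw [h, map_one]⟩, one_mem _⟩, h⟩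
  mul_mem' := by
    rintro x y ⟨⟨⟨hx, -⟩, hx0⟩, hx1⟩ ⟨⟨⟨hy, -⟩, hy0⟩, hy1⟩
    have h : normCl ((x * y : (Cl t s)ˣ) : Cl t s) = 1 := by
      rw [normCl, Units.val_mul, bar_mul, bar_eq_inv hx1, bar_eq_inv hy1, mul_assoc,
        Units.mul_inv_cancel_left, Units.mul_inv]
    exact ⟨⟨⟨mul_mem hx hy, 1, by simp, by rw [h, map_one]⟩, mul_mem hx0 hy0⟩, h⟩
  inv_mem' := by
    rintro x ⟨⟨⟨hx, -⟩, hx0⟩, hx1⟩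
    have hb := bar_eq_inv hx1
    have h : normCl ((x⁻¹ : (Cl t s)ˣ) : Cl t s) = 1 := by
      rw [normCl, ← hb, bar_bar_even hx0, hb, Units.inv_mul]
    exact ⟨⟨⟨inv_mem hx, 1, by simp, by rw [h, map_one]⟩, hb ▸ bar_even hx0⟩, h⟩

/-- `O(t,s)`: the invertible matrices `Λ` with `Λᵗ η Λ = η`. -/
def OGroup (t s : ℕ) : Subgroup (Matrix.GeneralLinearGroup (Fin t ⊕ Fin s) ℝ) where
  carrier := {A | (A.1)ᵀ * eta t s * A.1 = eta t s}
  one_mem' := by simp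
  mul_mem' := by
    intro A B hA hB
    have hA' : (A.1)ᵀ * eta t s * A.1 = eta t s := hA
    have hB' : (B.1)ᵀ * eta t s * B.1 = eta t s := hB
    change (A.1 * B.1)ᵀ * eta t s * (A.1 * B.1) = eta t s
    calc (A.1 * B.1)ᵀ * eta t s * (A.1 * B.1)
        = (B.1)ᵀ * ((A.1)ᵀ * eta t s * A.1) * B.1 := by
          rw [Matrix.transpose_mul]; simp only [Matrix.mul_assoc]
      _ = eta t s := by rw [hA', hB']
  inv_mem' := by
    intro A hA
    have hA' : (A.1)ᵀ * eta t s * A.1 = eta t s := hA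
    change ((A⁻¹).1)ᵀ * eta t s * (A⁻¹).1 = eta t s
    have h1 : A.1 * (A⁻¹).1 = 1 := A.mul_inv
    have h2 : ((A⁻¹).1)ᵀ * (A.1)ᵀ = 1 := by rw [← Matrix.transpose_mul, h1, Matrix.transpose_one]
    calc ((A⁻¹).1)ᵀ * eta t s * (A⁻¹).1
        = ((A⁻¹).1)ᵀ * ((A.1)ᵀ * eta t s * A.1) * (A⁻¹).1 := by rw [hA']
      _ = (((A⁻¹).1)ᵀ * (A.1)ᵀ) * eta t s * (A.1 * (A⁻¹).1) := by simp only [Matrix.mul_assoc]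
      _ = eta t s := by rw [h1, h2, Matrix.one_mul, Matrix.mul_one]

/-- The time-time block of a matrix. -/
def timeBlock {t s : ℕ} (A : Matrix (Fin t ⊕ Fin s) (Fin t ⊕ Fin s) ℝ) :
    Matrix (Fin t) (Fin t) ℝ :=
  A.toBlocks₁₁

/-- The value `η(x,x)` as a difference of sums of squares. -/
theorem eta_quad {t s : ℕ} (x : Fin t ⊕ Fin s → ℝ) :
    x ⬝ᵥ (eta t s *ᵥ x) = ∑ i, x (Sum.inl i) ^ 2 - ∑ j, x (Sum.inr j) ^ 2 := by
  simp [dotProduct, eta, Matrix.mulVec_diagonal, sgn, Fintype.sum_sum_type, sq, sub_eq_add_neg]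

theorem OGroup_quad {t s : ℕ} {A : Matrix.GeneralLinearGroup (Fin t ⊕ Fin s) ℝ} (hA : A ∈ OGroup t s)
    (x : Fin t ⊕ Fin s → ℝ) :
    (A.1 *ᵥ x) ⬝ᵥ (eta t s *ᵥ (A.1 *ᵥ x)) = x ⬝ᵥ (eta t s *ᵥ x) := by
  have hA' : (A.1)ᵀ * eta t s * A.1 = eta t s := hA
  conv_rhs => rw [← hA']
  rw [← Matrix.mulVec_mulVec, ← Matrix.mulVec_mulVec, Matrix.dotProduct_mulVec x,
    Matrix.vecMul_transpose]

/-- A time-like vector is sent by `O(t,s)` to a vector with non-zero time part. -/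
theorem OGroup_time_ne {t s : ℕ} {A : Matrix.GeneralLinearGroup (Fin t ⊕ Fin s) ℝ} (hA : A ∈ OGroup t s)
    {x : Fin t ⊕ Fin s → ℝ} (hx : ∑ j, x (Sum.inr j) ^ 2 < ∑ i, x (Sum.inl i) ^ 2) :
    (fun i => (A.1 *ᵥ x) (Sum.inl i)) ≠ 0 := by
  intro h0
  have h := OGroup_quad hA x
  rw [eta_quad, eta_quad] at h
  have h1 : ∑ i, (A.1 *ᵥ x) (Sum.inl i) ^ 2 = 0 :=
    Finset.sum_eq_zero fun i _ => by rw [congrFun h0 i]; simp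
  have h2 : 0 ≤ ∑ j, (A.1 *ᵥ x) (Sum.inr j) ^ 2 := Finset.sum_nonneg fun j _ => sq_nonneg _
  linarith

theorem timeBlock_mul_pos {t s : ℕ} {A B : Matrix.GeneralLinearGroup (Fin t ⊕ Fin s) ℝ} (hA : A ∈ OGroup t s)
    (hB : B ∈ OGroup t s) (hA0 : 0 < (timeBlock A.1).det) (hB0 : 0 < (timeBlock B.1).det) :
    0 < (timeBlock (A.1 * B.1)).det := by
  let F : ℝ → ℝ := fun r =>
    (A.1.toBlocks₁₁ * B.1.toBlocks₁₁ + r • (A.1.toBlocks₁₂ * B.1.toBlocks₂₁)).det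
  have hF : Continuous F := by
    refine Continuous.matrix_det ?_
    fun_prop
  have hF0 : 0 < F 0 := by
    simp only [F, zero_smul, add_zero, Matrix.det_mul]
    exact mul_pos hA0 hB0
  have hF1 : F 1 = (timeBlock (A.1 * B.1)).det := by
    simp only [F, one_smul, timeBlock]
    congr 1
    conv_rhs => rw [← Matrix.fromBlocks_toBlocks A.1, ← Matrix.fromBlocks_toBlocks B.1,
      Matrix.fromBlocks_multiply]
    rfl
  have hne : ∀ r ∈ Set.Icc (0 : ℝ) 1, F r ≠ 0 := by
    intro r hr h0
    obtain ⟨w, hw, hw0⟩ := Matrix.exists_mulVec_eq_zero_iff.2 h0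
    let z : Fin t ⊕ Fin s → ℝ := B.1 *ᵥ Sum.elim w 0
    have hz : ∑ i, z (Sum.inl i) ^ 2 - ∑ j, z (Sum.inr j) ^ 2 = ∑ i, w i ^ 2 := by
      have h := OGroup_quad hB (Sum.elim w 0)
      rw [eta_quad, eta_quad] at h
      simpa using h
    have hwpos : 0 < ∑ i, w i ^ 2 := by
      obtain ⟨i, hi⟩ := Function.ne_iff.1 hw
      exact Finset.sum_pos' (fun i _ => sq_nonneg _) ⟨i, Finset.mem_univ _, by
        have : w i ≠ 0 := hi
        positivity⟩
    have hzl : (fun i => z (Sum.inl i)) = B.1.toBlocks₁₁ *ᵥ w := by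
      ext i
      simp [z, Matrix.mulVec, dotProduct, Matrix.toBlocks₁₁]
    have hzr : (fun i => z (Sum.inr i)) = B.1.toBlocks₂₁ *ᵥ w := by
      ext i
      simp [z, Matrix.mulVec, dotProduct, Matrix.toBlocks₂₁]
    let y : Fin t ⊕ Fin s → ℝ :=
      Sum.elim (fun i => z (Sum.inl i)) (r • fun j => z (Sum.inr j))
    have hy : ∑ j, y (Sum.inr j) ^ 2 < ∑ i, y (Sum.inl i) ^ 2 := by
      have e : ∑ j, y (Sum.inr j) ^ 2 = r ^ 2 * ∑ j, z (Sum.inr j) ^ 2 := by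
        simp [y, mul_pow, Finset.mul_sum]
      have e' : ∑ i, y (Sum.inl i) ^ 2 = ∑ i, z (Sum.inl i) ^ 2 := by simp [y]
      have h2 : 0 ≤ ∑ j, z (Sum.inr j) ^ 2 := Finset.sum_nonneg fun j _ => sq_nonneg _
      have h3 : r ^ 2 ≤ 1 := by
        have := hr.1
        have := hr.2
        nlinarith
      rw [e, e']
      nlinarith
    refine OGroup_time_ne hA hy ?_
    rw [Matrix.add_mulVec, Matrix.smul_mulVec, ← Matrix.mulVec_mulVec, ← Matrix.mulVec_mulVec,
      ← hzl, ← hzr, ← Matrix.mulVec_smul] at hw0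
    rw [← hw0]
    ext i
    simp [y, Matrix.mulVec, dotProduct, Matrix.toBlocks₁₁, Matrix.toBlocks₁₂]
  rw [← hF1]
  by_contra hcon
  obtain ⟨r, hr, hr0⟩ := intermediate_value_Icc' (zero_le_one' ℝ) hF.continuousOn
    ⟨not_lt.1 hcon, hF0.le⟩
  exact hne r hr hr0

theorem timeBlock_inv_det {t s : ℕ} {A : Matrix.GeneralLinearGroup (Fin t ⊕ Fin s) ℝ} (hA : A ∈ OGroup t s) :
    (timeBlock (A⁻¹).1).det = (timeBlock A.1).det := by
  have hA' : (A.1)ᵀ * eta t s * A.1 = eta t s := hA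
  have h1 : A.1 * (A⁻¹).1 = 1 := A.mul_inv
  have h2 : (A.1)ᵀ * eta t s = eta t s * (A⁻¹).1 := by
    calc (A.1)ᵀ * eta t s = (A.1)ᵀ * eta t s * (A.1 * (A⁻¹).1) := by rw [h1, Matrix.mul_one]
      _ = (A.1)ᵀ * eta t s * A.1 * (A⁻¹).1 := by simp only [Matrix.mul_assoc]
      _ = _ := by rw [hA']
  have h3 : timeBlock (A⁻¹).1 = (timeBlock A.1)ᵀ := by
    ext i j
    have h := congrFun (congrFun h2 (Sum.inl i)) (Sum.inl j)
    simpa [eta, sgn, timeBlock, Matrix.toBlocks₁₁] using h.symm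
  rw [h3, Matrix.det_transpose]

/-- `SO₊(t,s) = ℒ₊^↑`: the elements of `O(t,s)` with determinant `1` that preserve the
orientation of the time directions, i.e. whose time-time block has positive determinant. -/
def SOPlus (t s : ℕ) : Subgroup (Matrix.GeneralLinearGroup (Fin t ⊕ Fin s) ℝ) where
  carrier := {A | A ∈ OGroup t s ∧ A.1.det = 1 ∧ 0 < (timeBlock A.1).det}
  one_mem' := by
    refine ⟨one_mem _, by simp, ?_⟩
    have h : timeBlock (1 : Matrix (Fin t ⊕ Fin s) (Fin t ⊕ Fin s) ℝ) = 1 := by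
      ext i j
      simp [timeBlock, Matrix.toBlocks₁₁, Matrix.one_apply]
    simp [h]
  mul_mem' := by
    rintro A B ⟨hA, hA1, hA2⟩ ⟨hB, hB1, hB2⟩
    refine ⟨mul_mem hA hB, ?_, timeBlock_mul_pos hA hB hA2 hB2⟩
    rw [Units.val_mul, Matrix.det_mul, hA1, hB1, one_mul]
  inv_mem' := by
    rintro A ⟨hA, hA1, hA2⟩
    refine ⟨inv_mem hA, ?_, by rw [timeBlock_inv_det hA]; exact hA2⟩
    have h1 : A.1 * (A⁻¹).1 = 1 := A.mul_inv
    have h := congrArg Matrix.det h1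
    rwa [Matrix.det_mul, hA1, one_mul, Matrix.det_one] at h

end SpinCover

/-!
Conjugation maps `Spin₊(t,s)` onto `SO₊(t,s)` with kernel `{1, -1}` for the following reasons.

* An `x` of the Clifford algebra with `e_j x = α(x) e_j` for all `j` is a scalar
  (`exists_eq_algebraMap_of_twisted_commute`). The even elements of norm `1` among the scalars are
  `1` and `-1`, which gives the kernel.
* Reflections in anisotropic vectors generate `O(t,s)` (`mem_closure_reflections`), and the
  reflection in `v` is the twisted conjugation `w ↦ -v w v⁻¹`. So every `A ∈ O(t,s)` is the twisted
  conjugation by a product `y` of vectors (`exists_lift`). The parity of `y` is `det A`, and `y ỹ`,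
  with `ỹ` the reverse of `y`, is a real number `r`. A reflection in `v` reverses the orientation of
  time exactly when `η(v,v) > 0`, so `r · det A · det (time-time block of A) > 0`.
* If `A ∈ SO₊(t,s)`, then `y` is even and `r > 0`, and `y / √r` is a preimage of `A` in
  `Spin₊(t,s)`. If conversely `A` comes from `x ∈ Spin₊(t,s)`, then `x` is a scalar multiple of `y`
  by the first point, so `y` is even with `r > 0`, and `A ∈ SO₊(t,s)`.

The groups are closed subgroups of unit groups of finite-dimensional algebras, so the open mapping
theorem for `σ`-compact groups makes the homomorphism open; being open with discrete kernel, it is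
a covering map (`isCoveringMap_coverHom`). It is non-trivial because the path `R(θ)` joins `1` to
`-1` in `Spin₊(t,s)` and projects to a loop: comparing a section along this loop with `R` gives a
continuous function to `{1, -1}` that changes sign (`not_exists_section`).
-/

namespace SpinCover

variable {t s : ℕ}

/-! ### The bilinear form and the generators -/

theorem quadForm_apply (v : Fin t ⊕ Fin s → ℝ) :
    quadForm t s v = v ⬝ᵥ (eta t s *ᵥ v) := by
  simp only [quadForm, QuadraticMap.weightedSumSquares_apply, dotProduct, eta,
    Matrix.mulVec_diagonal, smul_eq_mul]
  exact Finset.sum_congr rfl fun i _ => by ring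

theorem eta_comm (v w : Fin t ⊕ Fin s → ℝ) :
    v ⬝ᵥ (eta t s *ᵥ w) = w ⬝ᵥ (eta t s *ᵥ v) := by
  simp only [dotProduct, eta, Matrix.mulVec_diagonal]
  exact Finset.sum_congr rfl fun i _ => by ring

theorem polar_quadForm (v w : Fin t ⊕ Fin s → ℝ) :
    QuadraticMap.polar (quadForm t s) v w = 2 * (v ⬝ᵥ (eta t s *ᵥ w)) := by
  simp only [QuadraticMap.polar, quadForm_apply, Matrix.mulVec_add, dotProduct_add,
    add_dotProduct, eta_comm w v]
  ring

theorem vec_mul_self (v : Fin t ⊕ Fin s → ℝ) :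
    vec t s v * vec t s v = algebraMap ℝ (Cl t s) (v ⬝ᵥ (eta t s *ᵥ v)) := by
  rw [CliffordAlgebra.ι_sq_scalar, quadForm_apply]

theorem vec_mul_vec_add_swap (v w : Fin t ⊕ Fin s → ℝ) :
    vec t s v * vec t s w + vec t s w * vec t s v =
      algebraMap ℝ (Cl t s) (2 * (v ⬝ᵥ (eta t s *ᵥ w))) := by
  rw [CliffordAlgebra.ι_mul_ι_add_swap, polar_quadForm]

theorem algebraMap_injective : Function.Injective (algebraMap ℝ (Cl t s)) :=
  (algebraMap ℝ (Cl t s)).injective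

theorem dotProduct_eta_single (v : Fin t ⊕ Fin s → ℝ) (i : Fin t ⊕ Fin s) :
    v ⬝ᵥ (eta t s *ᵥ Pi.single i 1) = sgn t s i * v i := by
  simp [eta, dotProduct, Matrix.mulVec_diagonal, Pi.single_apply, mul_comm]

theorem sgn_mul_self (i : Fin t ⊕ Fin s) : sgn t s i * sgn t s i = 1 := by
  cases i <;> simp [sgn]

theorem sgn_ne_zero (i : Fin t ⊕ Fin s) : sgn t s i ≠ 0 :=
  left_ne_zero_of_mul_eq_one (sgn_mul_self i)

theorem vec_injective : Function.Injective (vec t s) := by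
  rw [injective_iff_map_eq_zero]
  intro v hv
  ext i
  have h := vec_mul_vec_add_swap v (Pi.single i 1)
  rw [hv, zero_mul, mul_zero, add_zero, ← map_zero (algebraMap ℝ (Cl t s))] at h
  have h' := algebraMap_injective h
  rw [dotProduct_eta_single] at h'
  simpa [sgn_ne_zero] using h'.symm

theorem gen_mul_self (i : Fin t ⊕ Fin s) :
    (gen i : Cl t s) * gen i = algebraMap ℝ (Cl t s) (sgn t s i) := by
  rw [gen, vec_mul_self, dotProduct_eta_single]
  simp

theorem gen_mul_gen_of_ne {i j : Fin t ⊕ Fin s} (h : i ≠ j) :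
    (gen i : Cl t s) * gen j = -(gen j * gen i) := by
  rw [eq_neg_iff_add_eq_zero, gen, gen, vec_mul_vec_add_swap, dotProduct_eta_single]
  simp [h.symm]

theorem involute_gen (i : Fin t ⊕ Fin s) :
    CliffordAlgebra.involute (gen i : Cl t s) = -gen i :=
  CliffordAlgebra.involute_ι _

theorem vec_eq_sum_gen (v : Fin t ⊕ Fin s → ℝ) : vec t s v = ∑ i, v i • (gen i : Cl t s) := by
  conv_lhs => rw [pi_eq_sum_univ' v]
  simp only [map_sum, map_smul, gen]

/-! ### Finite dimension and the twisted centralizer of `E` -/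

/-- The subalgebra generated by the `e_i` with `i ∈ S`. -/
noncomputable def genSubalgebra (S : Finset (Fin t ⊕ Fin s)) : Subalgebra ℝ (Cl t s) :=
  Algebra.adjoin ℝ (gen '' (S : Set (Fin t ⊕ Fin s)))

theorem gen_mem_genSubalgebra {S : Finset (Fin t ⊕ Fin s)} {i : Fin t ⊕ Fin s} (hi : i ∈ S) :
    (gen i : Cl t s) ∈ genSubalgebra S :=
  Algebra.subset_adjoin ⟨i, hi, rfl⟩

theorem genSubalgebra_univ : genSubalgebra (Finset.univ : Finset (Fin t ⊕ Fin s)) = ⊤ := by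
  rw [eq_top_iff, ← CliffordAlgebra.adjoin_range_ι]
  refine Algebra.adjoin_le ?_
  rintro _ ⟨v, rfl⟩
  rw [vec_eq_sum_gen]
  exact sum_mem fun i _ => Subalgebra.smul_mem _ (gen_mem_genSubalgebra (Finset.mem_univ i)) _

theorem genSubalgebra_empty : genSubalgebra (∅ : Finset (Fin t ⊕ Fin s)) = ⊥ := by
  simp [genSubalgebra]

theorem involute_mem_genSubalgebra {S : Finset (Fin t ⊕ Fin s)} {x : Cl t s}
    (hx : x ∈ genSubalgebra S) : CliffordAlgebra.involute x ∈ genSubalgebra S := by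
  induction hx using Algebra.adjoin_induction with
  | mem x hx =>
    obtain ⟨i, hi, rfl⟩ := hx
    rw [involute_gen]
    exact neg_mem (gen_mem_genSubalgebra hi)
  | algebraMap r => simp
  | add x y _ _ hx hy => rw [map_add]; exact add_mem hx hy
  | mul x y _ _ hx hy => rw [map_mul]; exact mul_mem hx hy

theorem mul_gen_of_mem_genSubalgebra {S : Finset (Fin t ⊕ Fin s)} {j : Fin t ⊕ Fin s}
    (hj : j ∉ S) {x : Cl t s} (hx : x ∈ genSubalgebra S) :
    x * gen j = gen j * CliffordAlgebra.involute x := by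
  induction hx using Algebra.adjoin_induction with
  | mem x hx =>
    obtain ⟨i, hi, rfl⟩ := hx
    rw [involute_gen, mul_neg, gen_mul_gen_of_ne (ne_of_mem_of_not_mem hi hj)]
  | algebraMap r => simp [Algebra.commutes]
  | add x y _ _ hx hy => rw [map_add, add_mul, mul_add, hx, hy]
  | mul x y _ _ hx hy => rw [map_mul, mul_assoc, hy, ← mul_assoc, hx, mul_assoc]

/-- Adding one generator at most doubles the subalgebra: `A_{S ∪ {j}} = A_S + e_j A_S`. -/
theorem exists_eq_add_gen_mul {S : Finset (Fin t ⊕ Fin s)} {j : Fin t ⊕ Fin s} (hj : j ∉ S)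
    {x : Cl t s} (hx : x ∈ genSubalgebra (insert j S)) :
    ∃ a ∈ genSubalgebra S, ∃ b ∈ genSubalgebra S, x = a + gen j * b := by
  induction hx using Algebra.adjoin_induction with
  | mem x hx =>
    obtain ⟨i, hi, rfl⟩ := hx
    rcases Finset.mem_insert.1 (Finset.mem_coe.1 hi) with rfl | hi
    · exact ⟨0, zero_mem _, 1, one_mem _, by simp⟩
    · exact ⟨gen i, gen_mem_genSubalgebra hi, 0, zero_mem _, by simp⟩
  | algebraMap r => exact ⟨algebraMap ℝ _ r, Subalgebra.algebraMap_mem _ r, 0, zero_mem _, by simp⟩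
  | add x y _ _ hx hy =>
    obtain ⟨a, ha, b, hb, rfl⟩ := hx
    obtain ⟨c, hc, d, hd, rfl⟩ := hy
    exact ⟨a + c, add_mem ha hc, b + d, add_mem hb hd, by rw [mul_add]; abel⟩
  | mul x y _ _ hx hy =>
    obtain ⟨a, ha, b, hb, rfl⟩ := hx
    obtain ⟨c, hc, d, hd, rfl⟩ := hy
    refine ⟨a * c + sgn t s j • (CliffordAlgebra.involute b * d),
      add_mem (mul_mem ha hc) (Subalgebra.smul_mem _ (mul_mem (involute_mem_genSubalgebra hb) hd) _),
      CliffordAlgebra.involute a * d + b * c,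
      add_mem (mul_mem (involute_mem_genSubalgebra ha) hd) (mul_mem hb hc), ?_⟩
    have h1 : a * (gen j * d) = gen j * (CliffordAlgebra.involute a * d) := by
      rw [← mul_assoc, mul_gen_of_mem_genSubalgebra hj ha, mul_assoc]
    have h2 : gen j * b * (gen j * d) = sgn t s j • (CliffordAlgebra.involute b * d) := by
      rw [mul_assoc, ← mul_assoc b, mul_gen_of_mem_genSubalgebra hj hb, Algebra.smul_def,
        ← gen_mul_self]
      simp only [mul_assoc]
    rw [add_mul, mul_add, mul_add, h1, h2, mul_add, mul_assoc (gen j) b c]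
    abel

theorem finiteDimensional_genSubalgebra (S : Finset (Fin t ⊕ Fin s)) :
    FiniteDimensional ℝ (Subalgebra.toSubmodule (genSubalgebra S)) := by
  induction S using Finset.induction_on with
  | empty =>
    rw [genSubalgebra_empty]
    exact inferInstanceAs (FiniteDimensional ℝ (⊥ : Subalgebra ℝ (Cl t s)))
  | insert j S hj ih =>
    have : Subalgebra.toSubmodule (genSubalgebra (insert j S)) ≤
        Subalgebra.toSubmodule (genSubalgebra S) ⊔
          (Subalgebra.toSubmodule (genSubalgebra S)).map (LinearMap.mulLeft ℝ (gen j)) := by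
      intro x hx
      obtain ⟨a, ha, b, hb, rfl⟩ := exists_eq_add_gen_mul hj hx
      exact Submodule.add_mem_sup ha ⟨b, hb, rfl⟩
    exact Submodule.finiteDimensional_of_le this

instance finiteDimensional_Cl : FiniteDimensional ℝ (Cl t s) := by
  have h := finiteDimensional_genSubalgebra (Finset.univ : Finset (Fin t ⊕ Fin s))
  rw [genSubalgebra_univ, Algebra.top_toSubmodule] at h
  exact Module.finite_def.2 (Submodule.fg_top _ |>.1 h.fg_top)

/-- The twisted centralizer of `E` consists of the scalars. Writing `x = a + e_j b` with `a`, `b`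
free of `e_j`, the relation `e_j x = α(x) e_j` reads `2 η_{jj} b = 0`, so that `x` is free of
each `e_j` in turn. -/
theorem exists_eq_algebraMap_of_twisted_commute {x : Cl t s}
    (hx : ∀ j, gen j * x = CliffordAlgebra.involute x * gen j) :
    ∃ c : ℝ, x = algebraMap ℝ (Cl t s) c := by
  suffices h : ∀ S : Finset (Fin t ⊕ Fin s), x ∈ genSubalgebra S →
      ∃ c : ℝ, x = algebraMap ℝ (Cl t s) c from
    h Finset.univ (by rw [genSubalgebra_univ]; exact Algebra.mem_top)
  intro S
  induction S using Finset.induction_on with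
  | empty =>
    intro h
    rw [genSubalgebra_empty, Algebra.mem_bot] at h
    exact h.imp fun c hc => hc.symm
  | insert j S hj ih =>
    intro h
    obtain ⟨a, ha, b, hb, rfl⟩ := exists_eq_add_gen_mul hj h
    have h1 := hx j
    -- Moving `e_j` to the left of `α(a)` and `α(b)` turns `h1` into `2 η_{jj} b = 0`.
    have ha' := mul_gen_of_mem_genSubalgebra hj (involute_mem_genSubalgebra ha)
    have hb' := mul_gen_of_mem_genSubalgebra hj (involute_mem_genSubalgebra hb)
    rw [CliffordAlgebra.involute_involute] at ha' hb'
    rw [map_add, map_mul, involute_gen, add_mul, mul_add, ha', neg_mul, neg_mul, mul_assoc (gen j),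
      hb', add_right_inj, eq_neg_iff_add_eq_zero, ← two_smul ℝ, ← mul_assoc, gen_mul_self,
      ← Algebra.smul_def, smul_smul] at h1
    have hb0 : b = 0 :=
      (smul_eq_zero.1 h1).resolve_left (mul_ne_zero two_ne_zero (sgn_ne_zero j))
    subst hb0
    apply ih
    simpa using ha

/-! ### Reflections -/

theorem eta_mulVec_of_mem_OGroup {A : Matrix.GeneralLinearGroup (Fin t ⊕ Fin s) ℝ}
    (hA : A ∈ OGroup t s) (v w : Fin t ⊕ Fin s → ℝ) :
    (A.1 *ᵥ v) ⬝ᵥ (eta t s *ᵥ (A.1 *ᵥ w)) = v ⬝ᵥ (eta t s *ᵥ w) := by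
  have hA' : (A.1)ᵀ * eta t s * A.1 = eta t s := hA
  conv_rhs => rw [← hA']
  rw [← Matrix.mulVec_mulVec, ← Matrix.mulVec_mulVec, Matrix.dotProduct_mulVec v,
    Matrix.vecMul_transpose]

theorem transpose_mul_eta_mul {A : Matrix (Fin t ⊕ Fin s) (Fin t ⊕ Fin s) ℝ}
    (h : ∀ v w, (A *ᵥ v) ⬝ᵥ (eta t s *ᵥ (A *ᵥ w)) = v ⬝ᵥ (eta t s *ᵥ w)) :
    Aᵀ * eta t s * A = eta t s := by
  ext i j
  have := h (Pi.single i 1) (Pi.single j 1)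
  rw [← Matrix.vecMul_transpose, ← Matrix.dotProduct_mulVec, Matrix.mulVec_mulVec,
    Matrix.mulVec_mulVec] at this
  simpa [Matrix.mul_assoc] using this

/-- The reflection `w ↦ w - 2 (η(v,w) / η(v,v)) v` in the hyperplane orthogonal to `v`. -/
noncomputable def reflMatrix (v : Fin t ⊕ Fin s → ℝ) :
    Matrix (Fin t ⊕ Fin s) (Fin t ⊕ Fin s) ℝ :=
  1 - (2 / (v ⬝ᵥ (eta t s *ᵥ v))) • Matrix.vecMulVec v (eta t s *ᵥ v)

theorem reflMatrix_mulVec (v w : Fin t ⊕ Fin s → ℝ) :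
    reflMatrix v *ᵥ w =
      w - (2 * (v ⬝ᵥ (eta t s *ᵥ w)) / (v ⬝ᵥ (eta t s *ᵥ v))) • v := by
  rw [reflMatrix, Matrix.sub_mulVec, Matrix.one_mulVec, Matrix.smul_mulVec,
    Matrix.vecMulVec_mulVec, eta_comm v w, dotProduct_comm w]
  ext i
  simp
  ring

theorem vec_reflMatrix_mul {v : Fin t ⊕ Fin s → ℝ} (hv : v ⬝ᵥ (eta t s *ᵥ v) ≠ 0)
    (w : Fin t ⊕ Fin s → ℝ) :
    vec t s (reflMatrix v *ᵥ w) * vec t s v = -(vec t s v * vec t s w) := by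
  rw [reflMatrix_mulVec, map_sub, map_smul, sub_mul, smul_mul_assoc, vec_mul_self,
    Algebra.smul_def, ← map_mul (algebraMap ℝ (Cl t s)), div_mul_cancel₀ _ hv,
    ← vec_mul_vec_add_swap]
  abel

theorem reflMatrix_mul_self {v : Fin t ⊕ Fin s → ℝ} (hv : v ⬝ᵥ (eta t s *ᵥ v) ≠ 0) :
    reflMatrix v * reflMatrix v = 1 := by
  refine Matrix.ext_of_mulVec_single fun i => ?_
  rw [← Matrix.mulVec_mulVec, Matrix.one_mulVec, reflMatrix_mulVec, reflMatrix_mulVec]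
  simp only [Matrix.mulVec_sub, Matrix.mulVec_smul, dotProduct_sub, dotProduct_smul, smul_eq_mul]
  generalize v ⬝ᵥ (eta t s *ᵥ Pi.single i 1) = b
  generalize v ⬝ᵥ (eta t s *ᵥ v) = q at *
  ext k
  simp
  field_simp
  ring

/-- The reflection in an anisotropic vector, as an invertible matrix. -/
noncomputable def reflGL (v : Fin t ⊕ Fin s → ℝ) (hv : v ⬝ᵥ (eta t s *ᵥ v) ≠ 0) :
    Matrix.GeneralLinearGroup (Fin t ⊕ Fin s) ℝ :=
  ⟨reflMatrix v, reflMatrix v, reflMatrix_mul_self hv, reflMatrix_mul_self hv⟩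

theorem reflGL_mem_OGroup {v : Fin t ⊕ Fin s → ℝ} (hv : v ⬝ᵥ (eta t s *ᵥ v) ≠ 0) :
    reflGL v hv ∈ OGroup t s := by
  refine transpose_mul_eta_mul fun x y => ?_
  simp only [reflGL, reflMatrix_mulVec, Matrix.mulVec_sub, Matrix.mulVec_smul, dotProduct_sub,
    dotProduct_smul, sub_dotProduct, smul_dotProduct, smul_eq_mul, eta_comm x v]
  field_simp
  ring

theorem det_one_sub_smul_vecMulVec {n : Type*} [Fintype n] [DecidableEq n] (c : ℝ) (u v : n → ℝ) :
    (1 - c • Matrix.vecMulVec u v).det = 1 - c * (u ⬝ᵥ v) := by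
  have := Matrix.det_one_add_replicateCol_mul_replicateRow (ι := Unit) (-c • u) v
  rw [← Matrix.vecMulVec_eq, Matrix.smul_vecMulVec, dotProduct_smul, neg_smul,
    ← sub_eq_add_neg] at this
  rw [this, smul_eq_mul, dotProduct_comm]
  ring

theorem det_reflGL {v : Fin t ⊕ Fin s → ℝ} (hv : v ⬝ᵥ (eta t s *ᵥ v) ≠ 0) :
    (reflGL v hv).1.det = -1 := by
  change (reflMatrix v).det = -1
  rw [reflMatrix, det_one_sub_smul_vecMulVec, div_mul_cancel₀ _ hv]
  norm_num

/-- A reflection reverses the orientation of the time directions exactly when its axis is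
time-like. -/
theorem det_timeBlock_reflGL_mul_neg {v : Fin t ⊕ Fin s → ℝ} (hv : v ⬝ᵥ (eta t s *ᵥ v) ≠ 0) :
    (v ⬝ᵥ (eta t s *ᵥ v)) * (timeBlock (reflGL v hv).1).det < 0 := by
  have h : timeBlock (reflGL v hv).1 = 1 - (2 / (v ⬝ᵥ (eta t s *ᵥ v))) •
      Matrix.vecMulVec (fun i => v (Sum.inl i)) (fun i => v (Sum.inl i)) := by
    ext i j
    simp [timeBlock, Matrix.toBlocks₁₁, reflGL, reflMatrix, Matrix.vecMulVec_apply, eta,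
      Matrix.mulVec_diagonal, sgn, Matrix.one_apply]
  rw [h, det_one_sub_smul_vecMulVec, mul_sub, ← mul_assoc, mul_div_cancel₀ _ hv]
  rw [eta_quad] at hv ⊢
  have h1 : 0 ≤ ∑ i, v (Sum.inl i) ^ 2 := Finset.sum_nonneg fun i _ => sq_nonneg _
  have h2 : 0 ≤ ∑ j, v (Sum.inr j) ^ 2 := Finset.sum_nonneg fun i _ => sq_nonneg _
  have h3 : (fun i => v (Sum.inl i)) ⬝ᵥ (fun i => v (Sum.inl i)) = ∑ i, v (Sum.inl i) ^ 2 :=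
    Finset.sum_congr rfl fun i _ => (sq _).symm
  rw [h3]
  rcases h1.eq_or_lt with h | h
  · rcases h2.eq_or_lt with h' | h'
    · exact absurd (by rw [← h, ← h', sub_zero]) hv
    · linarith
  · linarith

/-! ### The orientation of time -/

theorem timeBlock_det_ne_zero {A : Matrix.GeneralLinearGroup (Fin t ⊕ Fin s) ℝ}
    (hA : A ∈ OGroup t s) : (timeBlock A.1).det ≠ 0 := by
  intro h0
  obtain ⟨w, hw, hw0⟩ := Matrix.exists_mulVec_eq_zero_iff.2 h0
  refine OGroup_time_ne hA (x := Sum.elim w 0) ?_ ?_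
  · obtain ⟨i, hi⟩ := Function.ne_iff.1 hw
    have hi : w i ≠ 0 := hi
    simpa using Finset.sum_pos' (fun i _ => sq_nonneg (w i)) ⟨i, Finset.mem_univ _, by positivity⟩
  · rw [← hw0]
    ext i
    simp [Matrix.mulVec, dotProduct, timeBlock, Matrix.toBlocks₁₁]

/-- The reversal of the single time direction `i`, which exchanges the two orientations of time. -/
def timeReversal (i : Fin t) : Matrix.GeneralLinearGroup (Fin t ⊕ Fin s) ℝ :=
  ⟨Matrix.diagonal (Function.update 1 (Sum.inl i) (-1)),
    Matrix.diagonal (Function.update 1 (Sum.inl i) (-1)),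
    by
      rw [Matrix.diagonal_mul_diagonal, ← Matrix.diagonal_one]
      congr 1
      ext j
      by_cases h : j = Sum.inl i <;> simp [h],
    by
      rw [Matrix.diagonal_mul_diagonal, ← Matrix.diagonal_one]
      congr 1
      ext j
      by_cases h : j = Sum.inl i <;> simp [h]⟩

theorem timeReversal_mem_OGroup (i : Fin t) : timeReversal (s := s) i ∈ OGroup t s := by
  change (Matrix.diagonal _)ᵀ * eta t s * Matrix.diagonal _ = eta t s
  rw [eta, Matrix.diagonal_transpose, Matrix.diagonal_mul_diagonal, Matrix.diagonal_mul_diagonal]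
  congr 1
  ext j
  by_cases h : j = Sum.inl i <;> simp [h]

theorem timeReversal_mul_self (i : Fin t) : timeReversal (s := s) i * timeReversal i = 1 :=
  Units.ext (timeReversal (s := s) i).mul_inv

theorem prod_update_one_neg_one (i : Fin t) :
    ∏ j : Fin t, Function.update (1 : Fin t ⊕ Fin s → ℝ) (Sum.inl i) (-1) (Sum.inl j) = -1 := by
  simp [Function.update_apply]

theorem det_timeBlock_mul_timeReversal (A : Matrix.GeneralLinearGroup (Fin t ⊕ Fin s) ℝ)
    (i : Fin t) : (timeBlock (A * timeReversal i).1).det = -(timeBlock A.1).det := by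
  have h : timeBlock (A * timeReversal i).1 = timeBlock A.1 * Matrix.diagonal
      (fun j => Function.update (1 : Fin t ⊕ Fin s → ℝ) (Sum.inl i) (-1) (Sum.inl j)) := by
    ext k l
    simp [timeBlock, timeReversal, Matrix.toBlocks₁₁, Matrix.mul_diagonal]
  rw [h, Matrix.det_mul, Matrix.det_diagonal, prod_update_one_neg_one, mul_neg_one]

theorem det_timeBlock_timeReversal_mul (A : Matrix.GeneralLinearGroup (Fin t ⊕ Fin s) ℝ)
    (i : Fin t) : (timeBlock (timeReversal i * A).1).det = -(timeBlock A.1).det := by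
  have h : timeBlock (timeReversal i * A).1 = Matrix.diagonal
      (fun j => Function.update (1 : Fin t ⊕ Fin s → ℝ) (Sum.inl i) (-1) (Sum.inl j)) *
        timeBlock A.1 := by
    ext k l
    simp [timeBlock, timeReversal, Matrix.toBlocks₁₁, Matrix.diagonal_mul]
  rw [h, Matrix.det_mul, Matrix.det_diagonal, prod_update_one_neg_one, neg_one_mul]

/-- The sign of the determinant of the time-time block is multiplicative on `O(t,s)`. Composing a
factor of negative sign with a time reversal reduces this to two factors of positive sign. -/
theorem timeBlock_mul_sign {A B : Matrix.GeneralLinearGroup (Fin t ⊕ Fin s) ℝ}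
    (hA : A ∈ OGroup t s) (hB : B ∈ OGroup t s) :
    0 < (timeBlock (A * B).1).det * ((timeBlock A.1).det * (timeBlock B.1).det) := by
  -- Without time directions all the blocks are `0 × 0` and have determinant `1`.
  rcases isEmpty_or_nonempty (Fin t) with ht | ⟨⟨i⟩⟩
  · simp
  have hD := timeReversal_mem_OGroup (s := s) i
  rcases (timeBlock_det_ne_zero hA).lt_or_gt with a | a <;>
    rcases (timeBlock_det_ne_zero hB).lt_or_gt with b | b
  · have h := timeBlock_mul_pos (mul_mem hA hD) (mul_mem hD hB)
      (by rw [det_timeBlock_mul_timeReversal]; linarith)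
      (by rw [det_timeBlock_timeReversal_mul]; linarith)
    rw [← Units.val_mul, mul_assoc, ← mul_assoc (timeReversal i), timeReversal_mul_self,
      one_mul] at h
    exact mul_pos h (mul_pos_of_neg_of_neg a b)
  · have h := timeBlock_mul_pos (mul_mem hD hA) hB
      (by rw [det_timeBlock_timeReversal_mul]; linarith) b
    rw [← Units.val_mul, mul_assoc, det_timeBlock_timeReversal_mul] at h
    exact mul_pos_of_neg_of_neg (by linarith) (mul_neg_of_neg_of_pos a b)
  · have h := timeBlock_mul_pos hA (mul_mem hB hD) a
      (by rw [det_timeBlock_mul_timeReversal]; linarith)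
    rw [← Units.val_mul, ← mul_assoc, det_timeBlock_mul_timeReversal] at h
    exact mul_pos_of_neg_of_neg (by linarith) (mul_neg_of_pos_of_neg a b)
  · exact mul_pos (timeBlock_mul_pos hA hB a b) (mul_pos a b)

/-! ### Reflections generate `O(t,s)` -/

/-- The reflections in anisotropic vectors. -/
def reflections (t s : ℕ) : Set (Matrix.GeneralLinearGroup (Fin t ⊕ Fin s) ℝ) :=
  {A | ∃ v, ∃ hv : v ⬝ᵥ (eta t s *ᵥ v) ≠ 0, A = reflGL v hv}

theorem reflGL_mul_self {v : Fin t ⊕ Fin s → ℝ} (hv : v ⬝ᵥ (eta t s *ᵥ v) ≠ 0) :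
    reflGL v hv * reflGL v hv = 1 :=
  Units.ext (reflMatrix_mul_self hv)

theorem mem_closure_of_reflGL_mul {A : Matrix.GeneralLinearGroup (Fin t ⊕ Fin s) ℝ}
    {v : Fin t ⊕ Fin s → ℝ} (hv : v ⬝ᵥ (eta t s *ᵥ v) ≠ 0)
    (h : reflGL v hv * A ∈ Submonoid.closure (reflections t s)) :
    A ∈ Submonoid.closure (reflections t s) := by
  have := mul_mem (Submonoid.subset_closure (s := reflections t s) ⟨v, hv, rfl⟩) h
  rwa [← mul_assoc, reflGL_mul_self, one_mul] at this

theorem reflMatrix_mulVec_of_orthogonal {v w : Fin t ⊕ Fin s → ℝ}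
    (h : v ⬝ᵥ (eta t s *ᵥ w) = 0) : reflMatrix v *ᵥ w = w := by
  rw [reflMatrix_mulVec, h]
  simp

/-- Of two vectors with the same value of `η`, the first is mapped to the second by one
reflection when their difference is anisotropic. -/
theorem reflMatrix_sub_mulVec {u e : Fin t ⊕ Fin s → ℝ}
    (hq : u ⬝ᵥ (eta t s *ᵥ u) = e ⬝ᵥ (eta t s *ᵥ e))
    (h : (u - e) ⬝ᵥ (eta t s *ᵥ (u - e)) ≠ 0) : reflMatrix (u - e) *ᵥ u = e := by
  have h1 : 2 * ((u - e) ⬝ᵥ (eta t s *ᵥ u)) = (u - e) ⬝ᵥ (eta t s *ᵥ (u - e)) := by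
    simp only [Matrix.mulVec_sub, dotProduct_sub, sub_dotProduct, hq, eta_comm e u]
    ring
  rw [reflMatrix_mulVec, h1, div_self h, one_smul, sub_sub_cancel]

/-- A weak form of the Cartan–Dieudonné theorem: reflections generate `O(t,s)`. The basis vectors
are fixed one at a time. If `u` is the image of `e = e_j`, the identity
`η(u-e,u-e) + η(u+e,u+e) = 4 η(e,e)` shows that `u - e` or `u + e` is anisotropic, and then one
reflection, respectively two, map `u` to `e` without moving the vectors already fixed. -/
theorem mem_closure_reflections {A : Matrix.GeneralLinearGroup (Fin t ⊕ Fin s) ℝ}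
    (hA : A ∈ OGroup t s) : A ∈ Submonoid.closure (reflections t s) := by
  suffices h : ∀ S : Finset (Fin t ⊕ Fin s), ∀ A ∈ OGroup t s,
      (∀ i ∉ S, A.1 *ᵥ Pi.single i 1 = Pi.single i 1) →
      A ∈ Submonoid.closure (reflections t s) from
    h Finset.univ A hA fun i hi => absurd (Finset.mem_univ i) hi
  intro S
  induction S using Finset.induction_on with
  | empty =>
    intro A _ h
    have : A = 1 := Units.ext (Matrix.ext_of_mulVec_single fun i => by
      rw [h i (Finset.notMem_empty i), Units.val_one, Matrix.one_mulVec])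
    rw [this]
    exact one_mem _
  | insert j S hj ih =>
    intro A hA h
    set e : Fin t ⊕ Fin s → ℝ := Pi.single j 1 with he
    set u := A.1 *ᵥ e with hu
    have hq : u ⬝ᵥ (eta t s *ᵥ u) = e ⬝ᵥ (eta t s *ᵥ e) := eta_mulVec_of_mem_OGroup hA e e
    have hqe : e ⬝ᵥ (eta t s *ᵥ e) = sgn t s j := by
      rw [he, dotProduct_eta_single]
      simp
    have he0 : e ⬝ᵥ (eta t s *ᵥ e) ≠ 0 := by rw [hqe]; exact sgn_ne_zero j
    have hei : ∀ i ∉ insert j S, e ⬝ᵥ (eta t s *ᵥ Pi.single i 1) = 0 := by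
      intro i hi
      have : i ≠ j := fun h => hi (h ▸ Finset.mem_insert_self i S)
      rw [dotProduct_eta_single, he]
      simp [this]
    have hui : ∀ i ∉ insert j S, u ⬝ᵥ (eta t s *ᵥ Pi.single i 1) = 0 := by
      intro i hi
      rw [← hei i hi, ← eta_mulVec_of_mem_OGroup hA e, h i hi]
    by_cases h1 : (u - e) ⬝ᵥ (eta t s *ᵥ (u - e)) = 0
    · have h2 : (u - -e) ⬝ᵥ (eta t s *ᵥ (u - -e)) ≠ 0 := by
        intro h2
        refine he0 ?_
        simp only [Matrix.mulVec_sub, Matrix.mulVec_neg, dotProduct_sub, sub_dotProduct,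
          dotProduct_neg, neg_dotProduct, hq] at h1 h2
        linarith
      refine mem_closure_of_reflGL_mul h2 (mem_closure_of_reflGL_mul he0
        (ih _ (mul_mem (reflGL_mem_OGroup _) (mul_mem (reflGL_mem_OGroup _) hA)) fun i hi => ?_))
      rw [Units.val_mul, Units.val_mul, ← Matrix.mulVec_mulVec, ← Matrix.mulVec_mulVec]
      change reflMatrix e *ᵥ (reflMatrix (u - -e) *ᵥ _) = _
      by_cases hij : i = j
      · rw [hij, ← he, ← hu, reflMatrix_sub_mulVec (by simpa [Matrix.mulVec_neg] using hq) h2,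
          Matrix.mulVec_neg, reflMatrix_mulVec, mul_div_cancel_right₀ _ he0, two_smul]
        simp
      · have hi' : i ∉ insert j S := by simp [hij, hi]
        rw [h i hi', reflMatrix_mulVec_of_orthogonal (v := u - -e),
          reflMatrix_mulVec_of_orthogonal (hei i hi')]
        rw [sub_neg_eq_add, add_dotProduct, hui i hi', hei i hi', add_zero]
    · refine mem_closure_of_reflGL_mul h1
        (ih _ (mul_mem (reflGL_mem_OGroup _) hA) fun i hi => ?_)
      rw [Units.val_mul, ← Matrix.mulVec_mulVec]
      change reflMatrix (u - e) *ᵥ _ = _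
      by_cases hij : i = j
      · rw [hij, ← he, ← hu, reflMatrix_sub_mulVec hq h1]
      · have hi' : i ∉ insert j S := by simp [hij, hi]
        rw [h i hi', reflMatrix_mulVec_of_orthogonal]
        rw [sub_dotProduct, hui i hi', hei i hi', sub_zero]

/-! ### Lifting `O(t,s)` to the Clifford algebra -/

/-- The product of anisotropic vectors attached to a product of reflections: every `A ∈ O(t,s)` is
the twisted conjugation by an invertible `x` whose parity is `det A`, and whose spinor norm
`r = x · reverse x` records, together with the parity, whether `A` preserves the orientation of
time. -/
theorem exists_lift {A : Matrix.GeneralLinearGroup (Fin t ⊕ Fin s) ℝ} (hA : A ∈ OGroup t s) :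
    ∃ (x : (Cl t s)ˣ) (r : ℝ),
      CliffordAlgebra.involute (x : Cl t s) = A.1.det • (x : Cl t s) ∧
      (x : Cl t s) * CliffordAlgebra.reverse (x : Cl t s) = algebraMap ℝ (Cl t s) r ∧
      0 < r * A.1.det * (timeBlock A.1).det ∧
      ∀ w, vec t s (A.1 *ᵥ w) * x = CliffordAlgebra.involute (x : Cl t s) * vec t s w := by
  suffices h : A ∈ OGroup t s ∧ ∃ (x : (Cl t s)ˣ) (r : ℝ),
      CliffordAlgebra.involute (x : Cl t s) = A.1.det • (x : Cl t s) ∧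
      (x : Cl t s) * CliffordAlgebra.reverse (x : Cl t s) = algebraMap ℝ (Cl t s) r ∧
      0 < r * A.1.det * (timeBlock A.1).det ∧
      ∀ w, vec t s (A.1 *ᵥ w) * x = CliffordAlgebra.involute (x : Cl t s) * vec t s w from h.2
  have hcl := mem_closure_reflections hA
  clear hA
  induction hcl using Submonoid.closure_induction with
  | mem A hA =>
    obtain ⟨v, hv, rfl⟩ := hA
    set q := v ⬝ᵥ (eta t s *ᵥ v) with hq
    have hx : vec t s v * (q⁻¹ • vec t s v) = 1 := by
      rw [mul_smul_comm, vec_mul_self, Algebra.smul_def, ← map_mul, inv_mul_cancel₀ hv, map_one]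
    have hx' : (q⁻¹ • vec t s v) * vec t s v = 1 := by
      rw [smul_mul_assoc, ← mul_smul_comm, hx]
    refine ⟨reflGL_mem_OGroup hv, ⟨vec t s v, q⁻¹ • vec t s v, hx, hx'⟩, q, ?_, ?_, ?_, ?_⟩
    · rw [det_reflGL]
      simp
    · rw [CliffordAlgebra.reverse_ι, vec_mul_self]
    · rw [det_reflGL]
      have := det_timeBlock_reflGL_mul_neg hv
      linarith
    · intro w
      rw [CliffordAlgebra.involute_ι, neg_mul]
      exact vec_reflMatrix_mul hv w
  | one =>
    refine ⟨one_mem _, 1, 1, by simp, by simp, ?_, by simp⟩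
    have h : timeBlock (1 : Matrix (Fin t ⊕ Fin s) (Fin t ⊕ Fin s) ℝ) = 1 := by
      ext i j
      simp [timeBlock, Matrix.toBlocks₁₁, Matrix.one_apply]
    simp [h]
  | mul A B _ _ hA hB =>
    obtain ⟨hA, x, a, hx1, hx2, hx3, hx4⟩ := hA
    obtain ⟨hB, y, b, hy1, hy2, hy3, hy4⟩ := hB
    refine ⟨mul_mem hA hB, x * y, a * b, ?_, ?_, ?_, ?_⟩
    · rw [Units.val_mul, Units.val_mul, map_mul, hx1, hy1, Matrix.det_mul, smul_mul_smul_comm]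
    · rw [Units.val_mul, CliffordAlgebra.reverse.map_mul, mul_assoc, ← mul_assoc (y : Cl t s), hy2,
        Algebra.commutes, ← mul_assoc, hx2, map_mul]
    · have h := mul_pos (mul_pos hx3 hy3) (timeBlock_mul_sign hA hB)
      have hne := mul_ne_zero (timeBlock_det_ne_zero hA) (timeBlock_det_ne_zero hB)
      rw [Units.val_mul, Matrix.det_mul, ← Units.val_mul]
      -- `h` is the goal multiplied by the square of `det A₁₁ · det B₁₁`.
      refine pos_of_mul_pos_left (b := ((timeBlock A.1).det * (timeBlock B.1).det) ^ 2) ?_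
        (sq_nonneg _)
      convert h using 1
      ring
    · intro w
      rw [Units.val_mul, Units.val_mul, ← Matrix.mulVec_mulVec, ← mul_assoc, hx4, mul_assoc, hy4,
        map_mul, mul_assoc]

/-! ### Conjugation by elements of `Spin₊(t,s)` -/

theorem matrix_ext_of_vec {A B : Matrix (Fin t ⊕ Fin s) (Fin t ⊕ Fin s) ℝ}
    (h : ∀ v, vec t s (A *ᵥ v) = vec t s (B *ᵥ v)) : A = B :=
  Matrix.ext_of_mulVec_single fun _ => vec_injective (h _)

theorem mem_even_of_involute_eq {x : Cl t s} (hx : CliffordAlgebra.involute x = x) :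
    x ∈ CliffordAlgebra.even (quadForm t s) := by
  obtain ⟨a, ha, b, hb, rfl⟩ := Submodule.mem_sup.1
    ((CliffordAlgebra.evenOdd_isCompl (Q := quadForm t s)).sup_eq_top ▸ Submodule.mem_top (x := x))
  rw [map_add, CliffordAlgebra.involute_eq_of_mem_even ha,
    CliffordAlgebra.involute_eq_of_mem_odd hb, add_right_inj, neg_eq_iff_add_eq_zero,
    ← two_smul ℝ, smul_eq_zero, or_iff_right two_ne_zero] at hx
  rw [hx, add_zero]
  exact ha

theorem bar_eq_reverse_of_mem_even {x : Cl t s}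
    (hx : x ∈ CliffordAlgebra.even (quadForm t s)) : bar x = CliffordAlgebra.reverse x := by
  rw [bar_apply, involute_pow_even _ hx]

theorem involute_eq_of_mem_SpinPlus {x : (Cl t s)ˣ} (hx : x ∈ SpinPlus t s) :
    CliffordAlgebra.involute (x : Cl t s) = x :=
  CliffordAlgebra.involute_eq_of_mem_even hx.1.2

theorem mul_reverse_of_mem_SpinPlus {x : (Cl t s)ˣ} (hx : x ∈ SpinPlus t s) :
    (x : Cl t s) * CliffordAlgebra.reverse (x : Cl t s) = 1 := by
  rw [← bar_eq_reverse_of_mem_even hx.1.2]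
  exact hx.2

theorem mem_SpinPlus_of {x : (Cl t s)ˣ} (h : x ∈ cliffordGroup t s)
    (he : (x : Cl t s) ∈ CliffordAlgebra.even (quadForm t s))
    (hr : (x : Cl t s) * CliffordAlgebra.reverse (x : Cl t s) = 1) : x ∈ SpinPlus t s := by
  have hN : normCl (x : Cl t s) = 1 := by rw [normCl, bar_eq_reverse_of_mem_even he, hr]
  exact ⟨⟨⟨h, 1, abs_one, by rw [hN, map_one]⟩, he⟩, hN⟩

theorem exists_matrix_conj {x : (Cl t s)ˣ} (hx : x ∈ cliffordGroup t s) :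
    ∃ A : Matrix (Fin t ⊕ Fin s) (Fin t ⊕ Fin s) ℝ, ∀ v,
      vec t s (A *ᵥ v) = (x : Cl t s) * vec t s v * ((x⁻¹ : (Cl t s)ˣ) : Cl t s) := by
  let f : (Fin t ⊕ Fin s → ℝ) →ₗ[ℝ] LinearMap.range (vec t s) :=
    (LinearMap.mulRight ℝ ((x⁻¹ : (Cl t s)ˣ) : Cl t s) ∘ₗ
      LinearMap.mulLeft ℝ (x : Cl t s) ∘ₗ vec t s).codRestrict _ fun v => hx v
  refine ⟨LinearMap.toMatrix' ((LinearEquiv.ofInjective _ vec_injective).symm.toLinearMap ∘ₗ f),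
    fun v => ?_⟩
  rw [LinearMap.toMatrix'_mulVec, LinearMap.comp_apply]
  exact congrArg Subtype.val ((LinearEquiv.ofInjective _ vec_injective).apply_symm_apply (f v))

/-- The matrix of a conjugation lies in `O(t,s)`, because `v w + w v = 2 η(v,w)` is a scalar and so
is fixed by the conjugation. -/
theorem exists_mem_OGroup_conj {x : (Cl t s)ˣ} (hx : x ∈ cliffordGroup t s) :
    ∃ A ∈ OGroup t s, ∀ v,
      vec t s (A.1 *ᵥ v) = (x : Cl t s) * vec t s v * ((x⁻¹ : (Cl t s)ˣ) : Cl t s) := by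
  obtain ⟨A, hA⟩ := exists_matrix_conj hx
  obtain ⟨B, hB⟩ := exists_matrix_conj (inv_mem hx)
  have hAB : A * B = 1 := matrix_ext_of_vec fun v => by
    rw [← Matrix.mulVec_mulVec, hA, hB, Matrix.one_mulVec]
    simp [mul_assoc]
  refine ⟨⟨A, B, hAB, mul_eq_one_comm.1 hAB⟩, transpose_mul_eta_mul fun v w => ?_, hA⟩
  have h := vec_mul_vec_add_swap (A *ᵥ v) (A *ᵥ w)
  have h' : vec t s (A *ᵥ v) * vec t s (A *ᵥ w) + vec t s (A *ᵥ w) * vec t s (A *ᵥ v) =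
      (x : Cl t s) * (vec t s v * vec t s w + vec t s w * vec t s v) *
        ((x⁻¹ : (Cl t s)ˣ) : Cl t s) := by
    simp only [hA, mul_add, add_mul, mul_assoc, Units.inv_mul_cancel_left]
  rw [h', vec_mul_vec_add_swap, ← Algebra.commutes, mul_assoc, Units.mul_inv, mul_one] at h
  have := algebraMap_injective h
  change (A *ᵥ v) ⬝ᵥ (eta t s *ᵥ (A *ᵥ w)) = _
  linarith

/-- Conjugation by an element `x` of `Spin₊` preserves the orientations of space-time and of time:
`x` differs by a scalar from the product of vectors that `exists_lift` attaches to its matrix, and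
this product is therefore even and has positive spinor norm. -/
theorem exists_mem_SOPlus_conj {x : (Cl t s)ˣ} (hx : x ∈ SpinPlus t s) :
    ∃ A ∈ SOPlus t s, ∀ v,
      vec t s (A.1 *ᵥ v) = (x : Cl t s) * vec t s v * ((x⁻¹ : (Cl t s)ˣ) : Cl t s) := by
  obtain ⟨A, hA, hconj⟩ := exists_mem_OGroup_conj hx.1.1.1
  obtain ⟨y, r, hy1, hy2, hy3, hy4⟩ := exists_lift hA
  have hxe := involute_eq_of_mem_SpinPlus hx
  have hxy : (y : Cl t s) * ((y⁻¹ * x : (Cl t s)ˣ) : Cl t s) = x := by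
    rw [← Units.val_mul, mul_inv_cancel_left]
  obtain ⟨c, hc⟩ := exists_eq_algebraMap_of_twisted_commute
    (x := ((y⁻¹ * x : (Cl t s)ˣ) : Cl t s)) fun j => by
      refine (y.isUnit.map (CliffordAlgebra.involute (Q := quadForm t s))).mul_left_cancel ?_
      rw [gen, ← mul_assoc, ← hy4, mul_assoc, hxy, ← mul_assoc, ← map_mul, hxy, hxe, hconj,
        Units.inv_mul_cancel_right]
  rw [hc, ← Algebra.commutes, ← Algebra.smul_def] at hxy
  have hdet : A.1.det = 1 := by
    have h : A.1.det • (x : Cl t s) = (1 : ℝ) • (x : Cl t s) := by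
      rw [one_smul]
      conv_rhs => rw [← hxe, ← hxy, map_smul, hy1, smul_comm, hxy]
    exact smul_left_injective ℝ x.ne_zero h
  have hcr : c ^ 2 * r = 1 := by
    have h := mul_reverse_of_mem_SpinPlus hx
    rw [← hxy, map_smul, smul_mul_smul_comm, hy2, Algebra.smul_def, ← map_mul,
      ← map_one (algebraMap ℝ (Cl t s))] at h
    rw [sq]
    exact algebraMap_injective h
  have hr : 0 < r := pos_of_mul_pos_right (hcr ▸ one_pos) (sq_nonneg c)
  rw [hdet, mul_one] at hy3
  exact ⟨A, ⟨hA, hdet, pos_of_mul_pos_right hy3 hr.le⟩, hconj⟩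

theorem exists_coverHom : ∃ p : SpinPlus t s →* SOPlus t s, ∀ x v,
    vec t s ((p x).1.1 *ᵥ v) =
      (x.1 : Cl t s) * vec t s v * ((x.1⁻¹ : (Cl t s)ˣ) : Cl t s) := by
  -- The matrix is unique by `matrix_ext_of_vec`, hence multiplicative in `x`.
  choose f hf hconj using fun x : SpinPlus t s => exists_mem_SOPlus_conj x.2
  refine ⟨MonoidHom.mk' (fun x => ⟨f x, hf x⟩) fun x y => ?_, hconj⟩
  refine Subtype.ext (Units.ext (matrix_ext_of_vec fun v => ?_))
  change vec t s ((f (x * y)).1 *ᵥ v) = vec t s (((f x).1 * (f y).1) *ᵥ v)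
  rw [← Matrix.mulVec_mulVec, hconj, hconj, hconj]
  simp [mul_assoc]

/-- The homomorphism `ρ : Spin₊(t,s) → SO₊(t,s)` given by conjugation. -/
noncomputable def coverHom (t s : ℕ) : SpinPlus t s →* SOPlus t s :=
  exists_coverHom.choose

theorem vec_coverHom (x : SpinPlus t s) (v : Fin t ⊕ Fin s → ℝ) :
    vec t s ((coverHom t s x).1.1 *ᵥ v) =
      (x.1 : Cl t s) * vec t s v * ((x.1⁻¹ : (Cl t s)ˣ) : Cl t s) :=
  exists_coverHom.choose_spec x v

theorem coverHom_eq_iff {x : SpinPlus t s} {A : SOPlus t s} :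
    coverHom t s x = A ↔ ∀ v, vec t s (A.1.1 *ᵥ v) =
      (x.1 : Cl t s) * vec t s v * ((x.1⁻¹ : (Cl t s)ˣ) : Cl t s) := by
  refine ⟨fun h v => h ▸ vec_coverHom x v, fun h => ?_⟩
  exact Subtype.ext (Units.ext (matrix_ext_of_vec fun v => by rw [vec_coverHom, h]))

/-- The lift of `A ∈ SO₊` along reflections is even of positive spinor norm; dividing by the square
root of the norm puts it into `Spin₊`. -/
theorem coverHom_surjective : Function.Surjective (coverHom t s) := by
  rintro ⟨A, hA, hdet, htime⟩
  obtain ⟨y, r, hy1, hy2, hy3, hy4⟩ := exists_lift hA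
  rw [hdet, one_smul] at hy1
  rw [hdet, mul_one] at hy3
  have hr : 0 < r := pos_of_mul_pos_left hy3 htime.le
  have hc : (Real.sqrt r)⁻¹ ≠ 0 := inv_ne_zero (Real.sqrt_pos.2 hr).ne'
  let x : (Cl t s)ˣ := Units.map (algebraMap ℝ (Cl t s)).toMonoidHom (Units.mk0 _ hc) * y
  have hx : (x : Cl t s) = (Real.sqrt r)⁻¹ • (y : Cl t s) := (Algebra.smul_def _ _).symm
  have hxe : CliffordAlgebra.involute (x : Cl t s) = x := by rw [hx, map_smul, hy1]
  have hconj : ∀ v, vec t s (A.1 *ᵥ v) =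
      (x : Cl t s) * vec t s v * ((x⁻¹ : (Cl t s)ˣ) : Cl t s) := by
    intro v
    rw [Units.eq_mul_inv_iff_mul_eq, hx, mul_smul_comm, hy4, hy1, smul_mul_assoc]
  have hrev : (x : Cl t s) * CliffordAlgebra.reverse (x : Cl t s) = 1 := by
    rw [hx, map_smul, smul_mul_smul_comm, hy2, Algebra.smul_def, ← map_mul, ← mul_inv,
      Real.mul_self_sqrt hr.le, inv_mul_cancel₀ hr.ne', map_one]
  exact ⟨⟨x, mem_SpinPlus_of (fun v => ⟨_, hconj v⟩) (mem_even_of_involute_eq hxe) hrev⟩,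
    coverHom_eq_iff.2 hconj⟩

theorem neg_one_mem_SpinPlus : (-1 : (Cl t s)ˣ) ∈ SpinPlus t s := by
  refine mem_SpinPlus_of (fun v => ⟨v, ?_⟩) ?_ ?_
  · rw [inv_neg, inv_one]
    simp
  · rw [Units.val_neg, Units.val_one]
    exact neg_mem (one_mem _)
  · simp

theorem coverHom_eq_one_iff {x : SpinPlus t s} :
    coverHom t s x = 1 ↔ x.1 = 1 ∨ x.1 = -1 := by
  rw [coverHom_eq_iff]
  constructor
  · intro h
    obtain ⟨c, hc⟩ := exists_eq_algebraMap_of_twisted_commute (x := (x.1 : Cl t s)) fun j => by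
      have := h (Pi.single j 1)
      rw [OneMemClass.coe_one, Units.val_one, Matrix.one_mulVec,
        Units.eq_mul_inv_iff_mul_eq] at this
      rw [involute_eq_of_mem_SpinPlus x.2]
      exact this
    have h1 := mul_reverse_of_mem_SpinPlus x.2
    rw [hc, CliffordAlgebra.reverse.commutes, ← map_mul, ← map_one (algebraMap ℝ (Cl t s))] at h1
    refine (mul_self_eq_one_iff.1 (algebraMap_injective h1)).imp ?_ ?_ <;>
      rintro rfl <;> exact Units.ext (by simp [hc])
  · rintro (h | h) v <;> rw [h] <;> simp

theorem one_ne_neg_one : (1 : (Cl t s)ˣ) ≠ -1 := by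
  intro h
  have h' := congrArg Units.val h
  rw [Units.val_neg, Units.val_one, ← map_one (algebraMap ℝ (Cl t s)), ← map_neg] at h'
  have := algebraMap_injective h'
  norm_num at this

/-! ### Topology and the covering property -/

instance isModuleTopology_Cl : IsModuleTopology ℝ (Cl t s) := ⟨rfl⟩

instance isTopologicalRing_Cl : IsTopologicalRing (Cl t s) :=
  IsModuleTopology.isTopologicalRing ℝ (Cl t s)

/-- Coordinates with respect to a basis, as a homeomorphism. -/
noncomputable def coordCl (t s : ℕ) :
    Cl t s ≃L[ℝ] (Fin (Module.finrank ℝ (Cl t s)) → ℝ) where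
  toLinearEquiv := (Module.finBasis ℝ (Cl t s)).equivFun
  continuous_toFun := IsModuleTopology.continuous_of_linearMap
    (Module.finBasis ℝ (Cl t s)).equivFun.toLinearMap
  continuous_invFun := IsModuleTopology.continuous_of_linearMap
    (Module.finBasis ℝ (Cl t s)).equivFun.symm.toLinearMap

instance t2Space_Cl : T2Space (Cl t s) :=
  (coordCl t s).toHomeomorph.isEmbedding.t2Space

instance sigmaCompactSpace_Cl : SigmaCompactSpace (Cl t s) :=
  (coordCl t s).toHomeomorph.isClosedEmbedding.sigmaCompactSpace

theorem continuous_linearMap_Cl (f : Cl t s →ₗ[ℝ] Cl t s) : Continuous f :=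
  IsModuleTopology.continuous_of_linearMap f

theorem continuous_vec : Continuous (vec t s) :=
  IsModuleTopology.continuous_of_linearMap (vec t s)

theorem isClosed_submodule_Cl (W : Submodule ℝ (Cl t s)) : IsClosed (W : Set (Cl t s)) :=
  W.closed_of_finiteDimensional

theorem isClosed_SpinPlus : IsClosed (SpinPlus t s : Set (Cl t s)ˣ) := by
  have h : (SpinPlus t s : Set (Cl t s)ˣ) =
      (⋂ v, {x : (Cl t s)ˣ | (x : Cl t s) * vec t s v * ((x⁻¹ : (Cl t s)ˣ) : Cl t s) ∈
        LinearMap.range (vec t s)}) ∩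
      {x | (x : Cl t s) ∈ Subalgebra.toSubmodule (CliffordAlgebra.even (quadForm t s))} ∩
      {x | normCl (x : Cl t s) = 1} := by
    ext x
    refine ⟨fun hx => ⟨⟨Set.mem_iInter.2 hx.1.1.1, hx.1.2⟩, hx.2⟩, fun hx => ?_⟩
    exact ⟨⟨⟨Set.mem_iInter.1 hx.1.1, 1, abs_one, by rw [map_one]; exact hx.2⟩, hx.1.2⟩, hx.2⟩
  have hval : Continuous fun x : (Cl t s)ˣ => (x : Cl t s) := Units.continuous_val
  rw [h]
  refine ((isClosed_iInter fun v => ?_).inter ?_).inter ?_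
  · exact (isClosed_submodule_Cl _).preimage
      ((hval.mul continuous_const).mul Units.continuous_coe_inv)
  · exact (isClosed_submodule_Cl _).preimage hval
  · exact isClosed_eq (hval.mul ((continuous_linearMap_Cl bar).comp hval)) continuous_const

instance sigmaCompactSpace_SpinPlus : SigmaCompactSpace (SpinPlus t s) := by
  have : SigmaCompactSpace (Cl t s)ᵐᵒᵖ :=
    (MulOpposite.opHomeomorph (M := Cl t s)).symm.isClosedEmbedding.sigmaCompactSpace
  have : SigmaCompactSpace (Cl t s)ˣ :=
    Units.isClosedEmbedding_embedProduct.sigmaCompactSpace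
  exact isClosed_SpinPlus.sigmaCompactSpace

theorem isClosed_SOPlus :
    IsClosed (SOPlus t s : Set (Matrix.GeneralLinearGroup (Fin t ⊕ Fin s) ℝ)) := by
  -- On `O(t,s)` the determinant of the time-time block does not vanish, so `0 < det` is closed.
  have h : (SOPlus t s : Set (Matrix.GeneralLinearGroup (Fin t ⊕ Fin s) ℝ)) =
      {A | (A.1)ᵀ * eta t s * A.1 = eta t s} ∩ {A | A.1.det = 1} ∩
        {A | 0 ≤ (timeBlock A.1).det} := by
    ext A
    exact ⟨fun hA => ⟨⟨hA.1, hA.2.1⟩, hA.2.2.le⟩, fun hA => ⟨hA.1.1, hA.1.2,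
      lt_of_le_of_ne hA.2 (timeBlock_det_ne_zero (A := A) hA.1.1).symm⟩⟩
  have hval : Continuous fun A : Matrix.GeneralLinearGroup (Fin t ⊕ Fin s) ℝ => A.1 :=
    Units.continuous_val
  have htime : Continuous fun A : Matrix.GeneralLinearGroup (Fin t ⊕ Fin s) ℝ =>
      timeBlock A.1 :=
    continuous_matrix fun i j => hval.matrix_elem _ _
  rw [h]
  refine ((isClosed_eq ?_ continuous_const).inter (isClosed_eq ?_ continuous_const)).inter
    (isClosed_le continuous_const htime.matrix_det)
  · exact (hval.matrix_transpose.matrix_mul continuous_const).matrix_mul hval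
  · exact hval.matrix_det

instance locallyCompactSpace_SOPlus : LocallyCompactSpace (SOPlus t s) := by
  have : LocallyCompactSpace (Matrix (Fin t ⊕ Fin s) (Fin t ⊕ Fin s) ℝ) :=
    inferInstanceAs (LocallyCompactSpace (Fin t ⊕ Fin s → Fin t ⊕ Fin s → ℝ))
  have : LocallyCompactSpace (Matrix (Fin t ⊕ Fin s) (Fin t ⊕ Fin s) ℝ)ᵐᵒᵖ :=
    MulOpposite.opHomeomorph.symm.isClosedEmbedding.locallyCompactSpace
  have : LocallyCompactSpace (Matrix.GeneralLinearGroup (Fin t ⊕ Fin s) ℝ) :=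
    Units.isClosedEmbedding_embedProduct.locallyCompactSpace
  exact isClosed_SOPlus.isClosedEmbedding_subtypeVal.locallyCompactSpace

theorem continuous_coverHom : Continuous (coverHom t s) := by
  obtain ⟨g, hg⟩ := (vec t s).exists_leftInverse_of_injective
    (LinearMap.ker_eq_bot.2 vec_injective)
  have hgc : Continuous g := IsModuleTopology.continuous_of_linearMap g
  have hval : Continuous fun x : SpinPlus t s => (x.1 : Cl t s) :=
    Units.continuous_val.comp continuous_subtype_val
  have hinv : Continuous fun x : SpinPlus t s => ((x.1⁻¹ : (Cl t s)ˣ) : Cl t s) :=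
    Units.continuous_coe_inv.comp continuous_subtype_val
  have hentry : ∀ (x : SpinPlus t s) i j, (coverHom t s x).1.1 i j =
      g ((x.1 : Cl t s) * vec t s (Pi.single j 1) * ((x.1⁻¹ : (Cl t s)ˣ) : Cl t s)) i := by
    intro x i j
    rw [← vec_coverHom, ← LinearMap.comp_apply, hg]
    simp
  have hmat : Continuous fun x : SpinPlus t s => (coverHom t s x).1.1 := by
    refine continuous_matrix fun i j => ?_
    simp only [hentry]
    exact (continuous_apply i).comp (hgc.comp ((hval.mul continuous_const).mul hinv))
  refine Continuous.subtype_mk (Units.continuous_iff.2 ⟨hmat, ?_⟩) _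
  have h : (fun x : SpinPlus t s => (((coverHom t s x).1⁻¹ :
      Matrix.GeneralLinearGroup (Fin t ⊕ Fin s) ℝ) : Matrix (Fin t ⊕ Fin s) (Fin t ⊕ Fin s) ℝ)) =
      fun x => (coverHom t s x⁻¹).1.1 := by
    ext1 x
    rw [map_inv]
    rfl
  exact h ▸ hmat.comp continuous_inv

/-- The element `-1` of `Spin₊(t,s)`. -/
noncomputable def negOne (t s : ℕ) : SpinPlus t s := ⟨-1, neg_one_mem_SpinPlus⟩

theorem one_ne_negOne : (1 : SpinPlus t s) ≠ negOne t s :=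
  fun h => one_ne_neg_one (congrArg Subtype.val h)

theorem coe_ker_coverHom : ((coverHom t s).ker : Set (SpinPlus t s)) = {1, negOne t s} := by
  ext x
  rw [SetLike.mem_coe, MonoidHom.mem_ker, coverHom_eq_one_iff]
  simp only [Set.mem_insert_iff, Set.mem_singleton_iff, Subtype.ext_iff, OneMemClass.coe_one, negOne]

theorem isDiscrete_ker_coverHom : IsDiscrete ((coverHom t s).ker : Set (SpinPlus t s)) := by
  rw [coe_ker_coverHom]
  exact (Set.toFinite _).isDiscrete

/-- A continuous surjective homomorphism from a `σ`-compact onto a locally compact group is open;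
as the kernel is discrete, it is a covering map. -/
theorem isCoveringMap_coverHom : IsCoveringMap (coverHom t s) := by
  have hopen := (coverHom t s).isOpenMap_of_sigmaCompact coverHom_surjective continuous_coverHom
  exact (Topology.IsQuotientMap.isQuotientCoveringMap_of_isDiscrete_ker_monoidHom
    (hopen.isQuotientMap continuous_coverHom coverHom_surjective)
    isDiscrete_ker_coverHom).isCoveringMap

theorem ncard_fiber_coverHom (A : SOPlus t s) : (coverHom t s ⁻¹' {A}).ncard = 2 := by
  obtain ⟨x, rfl⟩ := coverHom_surjective A
  have h : coverHom t s ⁻¹' {coverHom t s x} = {x, negOne t s * x} := by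
    ext y
    rw [Set.mem_preimage, Set.mem_singleton_iff, ← mul_inv_eq_one, ← map_inv, ← map_mul,
      ← MonoidHom.mem_ker, ← SetLike.mem_coe, coe_ker_coverHom]
    simp only [Set.mem_insert_iff, Set.mem_singleton_iff, mul_inv_eq_iff_eq_mul, one_mul]
  rw [h, Set.ncard_pair]
  intro h
  exact one_ne_negOne (mul_right_cancel ((one_mul x).trans h))

/-! ### The path from `1` to `-1` and the absence of sections -/

theorem vec_mul_vec_mul_vec_mem_range (a v : Fin t ⊕ Fin s → ℝ) :
    vec t s a * vec t s v * vec t s a ∈ LinearMap.range (vec t s) :=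
  ⟨_, (CliffordAlgebra.ι_mul_ι_mul_ι a v).symm⟩

/-- The product `u w` of two vectors with `η(u,u) η(w,w) = 1`, as a unit with inverse `w u`. -/
noncomputable def vecMulVecUnit (u w : Fin t ⊕ Fin s → ℝ)
    (h : (u ⬝ᵥ (eta t s *ᵥ u)) * (w ⬝ᵥ (eta t s *ᵥ w)) = 1) : (Cl t s)ˣ where
  val := vec t s u * vec t s w
  inv := vec t s w * vec t s u
  val_inv := by
    rw [mul_assoc, ← mul_assoc (vec t s w), vec_mul_self, Algebra.commutes, ← mul_assoc,
      vec_mul_self, ← map_mul, h, map_one]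
  inv_val := by
    rw [mul_assoc, ← mul_assoc (vec t s u), vec_mul_self, Algebra.commutes, ← mul_assoc,
      vec_mul_self, ← map_mul, mul_comm, h, map_one]

theorem vecMulVecUnit_mem_SpinPlus {u w : Fin t ⊕ Fin s → ℝ}
    (h : (u ⬝ᵥ (eta t s *ᵥ u)) * (w ⬝ᵥ (eta t s *ᵥ w)) = 1) :
    vecMulVecUnit u w h ∈ SpinPlus t s := by
  refine mem_SpinPlus_of (fun v => ?_) (mem_even_of_involute_eq ?_) ?_
  · obtain ⟨v', hv'⟩ := vec_mul_vec_mul_vec_mem_range w v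
    change vec t s u * vec t s w * vec t s v * (vec t s w * vec t s u) ∈ _
    have : vec t s u * vec t s w * vec t s v * (vec t s w * vec t s u) =
        vec t s u * (vec t s w * vec t s v * vec t s w) * vec t s u := by simp only [mul_assoc]
    rw [this, ← hv']
    exact vec_mul_vec_mul_vec_mem_range u v'
  · change CliffordAlgebra.involute (vec t s u * vec t s w) = vec t s u * vec t s w
    rw [map_mul, CliffordAlgebra.involute_ι, CliffordAlgebra.involute_ι, neg_mul_neg]
  · change vec t s u * vec t s w * CliffordAlgebra.reverse (vec t s u * vec t s w) = 1
    rw [CliffordAlgebra.reverse.map_mul, CliffordAlgebra.reverse_ι, CliffordAlgebra.reverse_ι]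
    exact (vecMulVecUnit u w h).mul_inv

/-- The vector `w(θ)` in the plane of `e_M`, `e_N` with
`e_M w(θ) = cos (θ/2) + sin (θ/2) e_M e_N`. -/
noncomputable def rotVec (M N : Fin t ⊕ Fin s) (θ : ℝ) : Fin t ⊕ Fin s → ℝ :=
  (sgn t s M * Real.cos (θ / 2)) • Pi.single M 1 + Real.sin (θ / 2) • Pi.single N 1

theorem gen_mul_vec_rotVec (M N : Fin t ⊕ Fin s) (θ : ℝ) :
    vec t s (Pi.single M 1) * vec t s (rotVec M N θ) =
      algebraMap ℝ (Cl t s) (Real.cos (θ / 2)) + Real.sin (θ / 2) • (gen M * gen N) := by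
  rw [rotVec, map_add, map_smul, map_smul, ← gen, ← gen, mul_add, mul_smul_comm, mul_smul_comm,
    gen_mul_self, Algebra.smul_def, ← map_mul, mul_right_comm, sgn_mul_self, one_mul]

theorem eta_rotVec {M N : Fin t ⊕ Fin s} (hMN : M ≠ N) (hs : sgn t s M = sgn t s N) (θ : ℝ) :
    ((Pi.single M 1 : Fin t ⊕ Fin s → ℝ) ⬝ᵥ (eta t s *ᵥ Pi.single M 1)) *
      (rotVec M N θ ⬝ᵥ (eta t s *ᵥ rotVec M N θ)) = 1 := by
  conv_lhs => enter [2]; rw [rotVec]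
  simp only [Matrix.mulVec_add, Matrix.mulVec_smul, dotProduct_add, dotProduct_smul,
    dotProduct_eta_single, smul_eq_mul, Pi.add_apply, Pi.smul_apply, Pi.single_apply, hMN,
    hMN.symm, if_true, if_false, ← hs]
  linear_combination (Real.cos (θ / 2) ^ 2 * (sgn t s M * sgn t s M + 1) +
    Real.sin (θ / 2) ^ 2) * sgn_mul_self M + Real.sin_sq_add_cos_sq (θ / 2)

theorem continuous_rotVec (M N : Fin t ⊕ Fin s) : Continuous (rotVec M N) := by
  unfold rotVec
  fun_prop

/-- The path `R(θ) = cos (θ/2) + sin (θ/2) e_M e_N` in `Spin₊(t,s)`. -/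
noncomputable def rotPath {M N : Fin t ⊕ Fin s} (hMN : M ≠ N) (hs : sgn t s M = sgn t s N) :
    C(ℝ, SpinPlus t s) where
  toFun θ := ⟨vecMulVecUnit _ _ (eta_rotVec hMN hs θ), vecMulVecUnit_mem_SpinPlus _⟩
  continuous_toFun := by
    refine Continuous.subtype_mk (Units.continuous_iff.2 ⟨?_, ?_⟩) _
    · exact continuous_const.mul (continuous_vec.comp (continuous_rotVec M N))
    · exact (continuous_vec.comp (continuous_rotVec M N)).mul continuous_const

theorem rotPath_apply {M N : Fin t ⊕ Fin s} (hMN : M ≠ N) (hs : sgn t s M = sgn t s N) (θ : ℝ) :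
    ((rotPath hMN hs θ).1 : Cl t s) =
      algebraMap ℝ (Cl t s) (Real.cos (θ / 2)) + Real.sin (θ / 2) • (gen M * gen N) :=
  gen_mul_vec_rotVec M N θ

theorem rotPath_zero {M N : Fin t ⊕ Fin s} (hMN : M ≠ N) (hs : sgn t s M = sgn t s N) :
    rotPath hMN hs 0 = 1 :=
  Subtype.ext (Units.ext (by rw [rotPath_apply]; simp))

theorem rotPath_two_pi {M N : Fin t ⊕ Fin s} (hMN : M ≠ N) (hs : sgn t s M = sgn t s N) :
    rotPath hMN hs (2 * Real.pi) = negOne t s :=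
  Subtype.ext (Units.ext (by rw [rotPath_apply]; simp [negOne]))

/-- The covering has no continuous section `σ`. Otherwise the quotient
`σ(ρ(R(θ))) R(θ)⁻¹` lies in the discrete kernel, hence does not depend on `θ`; but it changes sign
from `θ = 0` to `θ = 2π`, because `ρ ∘ R` is a loop while `R` joins `1` to `-1`. -/
theorem not_exists_section {M N : Fin t ⊕ Fin s} (hMN : M ≠ N) (hs : sgn t s M = sgn t s N) :
    ¬ ∃ σ : C(SOPlus t s, SpinPlus t s), ∀ g, coverHom t s (σ g) = g := by
  rintro ⟨σ, hσ⟩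
  let R := rotPath hMN hs
  have hcont : Continuous fun θ => σ (coverHom t s (R θ)) * (R θ)⁻¹ :=
    (σ.continuous.comp (continuous_coverHom.comp R.continuous)).mul R.continuous.inv
  have hconst := isPreconnected_univ.constant_of_mapsTo isDiscrete_ker_coverHom hcont.continuousOn
    (fun θ _ => by
      rw [SetLike.mem_coe, MonoidHom.mem_ker, map_mul, hσ, map_inv, mul_inv_cancel])
    (Set.mem_univ 0) (Set.mem_univ (2 * Real.pi))
  have hneg : coverHom t s (negOne t s) = 1 := by
    rw [← MonoidHom.mem_ker, ← SetLike.mem_coe, coe_ker_coverHom]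
    simp
  simp only [R, rotPath_zero, rotPath_two_pi, map_one, hneg, mul_right_inj, inv_inj] at hconst
  exact one_ne_negOne hconst

theorem exists_ne_of_two_le (h : 2 ≤ t ∨ 2 ≤ s) :
    ∃ M N : Fin t ⊕ Fin s, M ≠ N ∧ sgn t s M = sgn t s N := by
  rcases h with h | h
  · exact ⟨Sum.inl ⟨0, by omega⟩, Sum.inl ⟨1, by omega⟩, by simp, rfl⟩
  · exact ⟨Sum.inr ⟨0, by omega⟩, Sum.inr ⟨1, by omega⟩, by simp, rfl⟩

end SpinCover

theorem mainTheorem6 (t s : ℕ) :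
    ∃ p : SpinCover.SpinPlus t s →* SpinCover.SOPlus t s,
      -- `p x` is the conjugation `v ↦ x v x⁻¹`, which on `Spin₊` is the twisted conjugation
      (∀ (x : SpinCover.SpinPlus t s) (v : Fin t ⊕ Fin s → ℝ),
        SpinCover.vec t s ((p x).1.1 *ᵥ v) =
            (x.1 : SpinCover.Cl t s) * SpinCover.vec t s v *
              ((x.1⁻¹ : (SpinCover.Cl t s)ˣ) : SpinCover.Cl t s) ∧
        SpinCover.vec t s ((p x).1.1 *ᵥ v) =
            CliffordAlgebra.involute (x.1 : SpinCover.Cl t s) * SpinCover.vec t s v *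
              ((x.1⁻¹ : (SpinCover.Cl t s)ˣ) : SpinCover.Cl t s)) ∧
      -- it is a double covering: onto, with kernel `{1, -1}`, and a two-sheeted covering map
      Function.Surjective p ∧
      (∀ x : (SpinCover.Cl t s)ˣ,
        (∃ hx : x ∈ SpinCover.SpinPlus t s, p ⟨x, hx⟩ = 1) ↔ x = 1 ∨ x = -1) ∧
      Continuous p ∧
      IsCoveringMap p ∧
      (∀ g : SpinCover.SOPlus t s, (p ⁻¹' {g}).ncard = 2) ∧
      -- the path `cos (θ/2) + sin (θ/2) e_M e_N` inside `Spin₊` joins `1` to `-1`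
      (∀ M N : Fin t ⊕ Fin s, M ≠ N → SpinCover.sgn t s M = SpinCover.sgn t s N →
        ∃ R : C(ℝ, SpinCover.SpinPlus t s),
          (∀ θ : ℝ, ((R θ).1 : SpinCover.Cl t s) =
            algebraMap ℝ (SpinCover.Cl t s) (Real.cos (θ / 2)) +
              Real.sin (θ / 2) • (SpinCover.gen M * SpinCover.gen N)) ∧
          (R 0).1 = 1 ∧ (R (2 * Real.pi)).1 = -1) ∧
      -- the covering is non-trivial: not a product with a two-point space, no continuous section
      (2 ≤ t ∨ 2 ≤ s →
        ¬ IsHomeomorphicTrivialFiberBundle (Fin 2) p ∧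
        ¬ ∃ σ : C(SpinCover.SOPlus t s, SpinCover.SpinPlus t s), ∀ g, p (σ g) = g) := by

  refine ⟨SpinCover.coverHom t s, fun x v => ⟨SpinCover.vec_coverHom x v, ?_⟩,
    SpinCover.coverHom_surjective, fun x => ?_,
    SpinCover.continuous_coverHom, SpinCover.isCoveringMap_coverHom,
    SpinCover.ncard_fiber_coverHom, fun M N hMN hs => ?_,
    fun h => ?_⟩
  · rw [SpinCover.involute_eq_of_mem_SpinPlus x.2, SpinCover.vec_coverHom]
  · refine ⟨fun ⟨hx, h⟩ => SpinCover.coverHom_eq_one_iff.1 h, fun h => ?_⟩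
    have hx : x ∈ SpinCover.SpinPlus t s := by
      rcases h with rfl | rfl
      · exact one_mem _
      · exact SpinCover.neg_one_mem_SpinPlus
    exact ⟨hx, SpinCover.coverHom_eq_one_iff.2 h⟩
  · exact ⟨SpinCover.rotPath hMN hs, SpinCover.rotPath_apply hMN hs,
      congrArg Subtype.val (SpinCover.rotPath_zero hMN hs),
      congrArg Subtype.val (SpinCover.rotPath_two_pi hMN hs)⟩
  · obtain ⟨M, N, hMN, hs⟩ := SpinCover.exists_ne_of_two_le h
    have hsec := SpinCover.not_exists_section hMN hs
    refine ⟨fun ⟨e, he⟩ => hsec ⟨⟨fun g => e.symm (g, 0), by fun_prop⟩, fun g => ?_⟩, hsec⟩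
    change SpinCover.coverHom t s (e.symm (g, 0)) = g
    rw [← he, e.apply_symm_apply]
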